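/- Let $N=2n$ be an even number of sites, $\nu\ge 1$, and $1\le \ell\le\nu$. Each site $i\in\{1,\dots,N\}$ carries $\nu+1$ qubits $(i,0),\dots,(i,\nu)$ with Pauli operators $X_i^{(m)},Y_i^{(m)},Z_i^{(m)}$. Put $S_i=\prod_{j<i}\prod_{m=0}^{\nu}Z_j^{(m)}$, $Z_{i,<\ell}=\prod_{m<\ell}Z_i^{(m)}$, $Z_{i,\le\nu}=\prod_{m=0}^{\nu}Z_i^{(m)}$ and define the Jordan--Wigner modes and Majorana operators $$b_i^{(\ell)}=S_iZ_{i,<\ell}\tfrac{X_i^{(\ell)}-iY_i^{(\ell)}}{2},\qquad c_i=b_i^{(\ell)}+b_i^{(\ell)\dagger},\qquad d_i=-i\bigl(b_i^{(\ell)}-b_i^{(\ell)\dagger}\bigr),$$ the stabilizers $P_{ij}=i\,c_id_j$, and the ordered operator $$\mathcal C_{\mathrm{ord}}^{(\ell)}=2^{-N/4}(c_1-id_2)(c_3-id_4)\cdots(c_{N-1}-id_N).$$ (1) Locality. For $1\le k\le N/2$ let $$\tilde c_{2k-1}=Z_{2k-1,<\ell}\,X^{(\ell)}_{2k-1}\,(Z_{2k-1,\le\nu}Z_{2k,\le\nu})^{N/2-k},\qquad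 \tilde d_{2k}=-Z_{2k-1,\le\nu}\,Z_{2k,<\ell}\,Y^{(\ell)}_{2k}\,(Z_{2k-1,\le\nu}Z_{2k,\le\nu})^{N/2-k}.$$ Then $\mathcal C_{\mathrm{ord}}^{(\ell)}=2^{-N/4}\prod_{k=1}^{N/2}(\tilde c_{2k-1}-i\tilde d_{2k})$. The operators $\tilde c_{2k-1},\tilde d_{2k}$ act only on the qubits of the sites $2k-1,2k$, so that their Pauli weights are at most $2(\nu+1)$ and different $k$ involve disjoint sets of qubits. (2) Unitary embedding. Add $N/2$ ancilla qubits and let $$\tilde{\mathcal U}_k=|0\rangle\langle0|_{\mathrm{anc},k}\,\tilde c_{2k-1}+|1\rangle\langle1|_{\mathrm{anc},k}\,(-i\tilde d_{2k}),\qquad \mathcal U_{\mathrm{ord}}=\prod_{k=1}^{N/2}\tilde{\mathcal U}_k.$$ Each $\tilde{\mathcal U}_k$ is unitary and acts only on the $k$-th ancilla and the qubits of the sites $2k-1,2k$; these sets of qubits are disjoint for different $k$. Hence $\mathcal U_{\mathrm{ord}}$ and $W=\mathrm H_{\mathrm{anc}}\,\mathcal U_{\mathrm{ord}}\,\mathrm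 H_{\mathrm{anc}}$ are unitary, where $\mathrm H_{\mathrm{anc}}$ applies a Hadamard gate to every ancilla. (3) Measurement and sign correction. For every system state $\psi$ and every outcome $m\in\{0,1\}^{N/2}$ of a computational-basis measurement of the ancillas in the state $W(|0\cdots0\rangle_{\mathrm{anc}}\otimes\psi)$, the (unnormalized) resulting system state is $$\psi_m=2^{-N/2}\Bigl[\prod_{k=1}^{N/2}\bigl(c_{2k-1}-(-1)^{m_k}i\,d_{2k}\bigr)\Bigr]\psi ,$$ and it satisfies $(-1)^{m_k}P_{2k-1,2k}\,\psi_m=\psi_m$ for every $k$, i.e. it is stabilized by the sign-corrected stabilizers. In particular $\psi_{0}=2^{-N/4}\,\mathcal C_{\mathrm{ord}}^{(\ell)}\psi$. (4) Depth. There is an absolute constant $K$ (independent of $N$, $\nu$, $\ell$) such that $\mathcal U_{\mathrm{ord}}$ and $W$ are each implemented exactly, on the $N(\nu+1)$ system qubits and the $N/2$ ancillas without any further qubits, by a circuit of depth at most $K(1+\log\nu)$ consisting of Hadamard, $X$, CNOT and CZ gates between arbitrary pairs of qubits; depth is the number of layers of gates acting on disjoint qubits. -/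

import Mathlib

open Matrix

noncomputable section

namespace OrderedPrep

/-! ### Qubit registers and operators -/

/-- Computational basis labels of a register of qubits indexed by `Q`. -/
abbrev Basis (Q : Type) : Type := Q → Fin 2

/-- Operators on the Hilbert space `(ℂ²)^{⊗ Q}`, as matrices in the computational basis. -/
abbrev Op (Q : Type) : Type := Matrix (Basis Q) (Basis Q) ℂ

/-- State vectors (not necessarily normalized) in `(ℂ²)^{⊗ Q}`. -/
abbrev Ket (Q : Type) : Type := Basis Q → ℂ

def matX : Matrix (Fin 2) (Fin 2) ℂ := !![0, 1; 1, 0]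
def matY : Matrix (Fin 2) (Fin 2) ℂ := !![0, -Complex.I; Complex.I, 0]
def matZ : Matrix (Fin 2) (Fin 2) ℂ := !![1, 0; 0, -1]
def matH : Matrix (Fin 2) (Fin 2) ℂ := ((Real.sqrt 2 : ℝ) : ℂ)⁻¹ • !![1, 1; 1, -1]
/-- `|0⟩⟨0|` -/
def proj0 : Matrix (Fin 2) (Fin 2) ℂ := !![1, 0; 0, 0]
/-- `|1⟩⟨1|` -/
def proj1 : Matrix (Fin 2) (Fin 2) ℂ := !![0, 0; 0, 1]

section Register

variable {Q : Type} [Fintype Q] [DecidableEq Q]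

/-- The single-qubit operator `A` on qubit `q`, tensored with the identity on all others. -/
def onQubit (A : Matrix (Fin 2) (Fin 2) ℂ) (q : Q) : Op Q :=
  Matrix.of fun x y => if ∀ r, r ≠ q → x r = y r then A (x q) (y q) else 0

/-- The product of the Pauli `Z` operators on the qubits in `T` (they commute, so the order in
which the list enumerates `T` is irrelevant). -/
def zString (T : Finset Q) : Op Q := (T.toList.map fun q => onQubit matZ q).prod

/-- `A` acts only on the qubits in `T`: `A = B ⊗ 1` with `B` an operator on the qubits in `T`. -/
def SupportedOn (A : Op Q) (T : Finset Q) : Prop :=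
  ∃ B : Matrix ({q // q ∈ T} → Fin 2) ({q // q ∈ T} → Fin 2) ℂ, ∀ x y : Basis Q,
    A x y = if ∀ q, q ∉ T → x q = y q then B (fun q => x q) (fun q => y q) else 0

/-- The weight of `A`: the number of qubits on which it acts non-trivially. -/
def weight (A : Op Q) : ℕ := Set.ncard {q : Q | ¬ SupportedOn A (Finset.univ.erase q)}

/-- The operator `|0⟩⟨0|_c ⊗ 1 + |1⟩⟨1|_c ⊗ A_t`, for `c ≠ t`. -/
def controlled (A : Matrix (Fin 2) (Fin 2) ℂ) (c t : Q) : Op Q :=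
  onQubit proj0 c + onQubit proj1 c * onQubit A t

end Register

/-! ### Circuits and depth -/

/-- The elementary gates: Hadamard, Pauli `X`, `CNOT` and `CZ`, between arbitrary qubits. -/
inductive Gate (Q : Type) : Type
  | had (q : Q) : Gate Q
  | x (q : Q) : Gate Q
  | cx (c t : Q) (h : c ≠ t) : Gate Q
  | cz (c t : Q) (h : c ≠ t) : Gate Q

section Circuits

variable {Q : Type} [Fintype Q] [DecidableEq Q]

/-- The qubits a gate touches. -/
def Gate.qubits : Gate Q → Finset Q
  | .had q => {q}
  | .x q => {q}
  | .cx c t _ => {c, t}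
  | .cz c t _ => {c, t}

/-- The unitary of a gate. -/
def Gate.op : Gate Q → Op Q
  | .had q => onQubit matH q
  | .x q => onQubit matX q
  | .cx c t _ => controlled matX c t
  | .cz c t _ => controlled matZ c t

/-- A layer: gates executed in parallel, on pairwise disjoint sets of qubits. -/
structure Layer (Q : Type) [DecidableEq Q] : Type where
  gates : List (Gate Q)
  disjoint : gates.Pairwise fun g g' => Disjoint g.qubits g'.qubits

def Layer.op (L : Layer Q) : Op Q := (L.gates.map Gate.op).prod

/-- A circuit is a sequence of layers; the head of the list is executed first. -/
abbrev Circuit (Q : Type) [DecidableEq Q] : Type := List (Layer Q)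

/-- The depth of a circuit is its number of layers. -/
def Circuit.depth (C : Circuit Q) : ℕ := List.length C

/-- The unitary implemented by a circuit. -/
def Circuit.op (C : Circuit Q) : Op Q := (C.map Layer.op).reverse.prod

end Circuits

/-! ### The fermionic operators under the Jordan–Wigner encoding -/

/-- The qubits of `N` sites with `ν + 1` modes each; mode `0` is physical, `1, …, ν` are auxiliary.
The Jordan–Wigner order is lexicographic. Sites are numbered from `0`. -/
abbrev SysQ (N ν : ℕ) : Type := Fin N × Fin (ν + 1)

section Fermions

variable {N ν : ℕ}

/-- `S_i = ∏_{j < i} ∏_{k = 0}^{ν} Z_j^{(k)}` -/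
def strS (i : Fin N) : Op (SysQ N ν) := zString (Finset.univ.filter fun q => q.1 < i)

/-- `Z_{i,<ℓ} = ∏_{m < ℓ} Z_i^{(m)}` -/
def strZlt (i : Fin N) (l : Fin (ν + 1)) : Op (SysQ N ν) :=
  zString (Finset.univ.filter fun q => q.1 = i ∧ q.2 < l)

/-- `Z_{i,≤ν} = ∏_{m = 0}^{ν} Z_i^{(m)}` -/
def strZall (i : Fin N) : Op (SysQ N ν) := zString (Finset.univ.filter fun q => q.1 = i)

/-- The fermionic mode `b_i^{(ℓ)} = S_i Z_{i,<ℓ} (X_i^{(ℓ)} - i Y_i^{(ℓ)}) / 2`. -/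
def modeB (l : Fin (ν + 1)) (i : Fin N) : Op (SysQ N ν) :=
  strS i * strZlt i l *
    ((2 : ℂ)⁻¹ • (onQubit matX (i, l) - Complex.I • onQubit matY (i, l)))

/-- The Majorana operator `c_i^{(ℓ)} = b + b†`. -/
def majC (l : Fin (ν + 1)) (i : Fin N) : Op (SysQ N ν) := modeB l i + (modeB l i)ᴴ

/-- The Majorana operator `d_i^{(ℓ)} = -i (b - b†)`. -/
def majD (l : Fin (ν + 1)) (i : Fin N) : Op (SysQ N ν) :=
  (-Complex.I) • (modeB l i - (modeB l i)ᴴ)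

/-- The stabilizer `P_{ij}^{(ℓ)} = i c_i^{(ℓ)} d_j^{(ℓ)}`. -/
def stab (l : Fin (ν + 1)) (i j : Fin N) : Op (SysQ N ν) := Complex.I • (majC l i * majD l j)

end Fermions

/-! ### The ordered operator; `N = 2 n` sites, grouped in `n` consecutive pairs -/

section Ordered

variable {n ν : ℕ}

/-- First site of the `k`-th pair (site `2k-1` if both are counted from `1`). -/
def fstSite (k : Fin n) : Fin (2 * n) := ⟨2 * k, by omega⟩

/-- Second site of the `k`-th pair (site `2k` if both are counted from `1`). -/
def sndSite (k : Fin n) : Fin (2 * n) := ⟨2 * k + 1, by omega⟩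

/-- The `2 (ν + 1)` qubits of the `k`-th pair of sites. -/
def pairQubits (ν : ℕ) (k : Fin n) : Finset (SysQ (2 * n) ν) :=
  Finset.univ.filter fun q => q.1 = fstSite k ∨ q.1 = sndSite k

/-- `C_ord^{(ℓ)} = 2^{-N/4} (c_1 - i d_2)(c_3 - i d_4) ⋯ (c_{N-1} - i d_N)`, `N = 2 n`. -/
def cOrd (l : Fin (ν + 1)) : Op (SysQ (2 * n) ν) :=
  (((2 : ℝ) ^ (((2 * n : ℕ) : ℝ) / 4) : ℝ) : ℂ)⁻¹ •
    (List.ofFn fun k : Fin n => majC l (fstSite k) - Complex.I • majD l (sndSite k)).prod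

/-- `(Z_{2k-1,≤ν} Z_{2k,≤ν})^{N/2-k}` (`k` counted from `1`; here `k` is counted from `0`). -/
def residualZ (ν : ℕ) (k : Fin n) : Op (SysQ (2 * n) ν) :=
  (strZall (fstSite k) * strZall (sndSite k)) ^ (n - (k + 1))

/-- `c̃_{2k-1} = Z_{2k-1,<ℓ} X_{2k-1}^{(ℓ)} (Z_{2k-1,≤ν} Z_{2k,≤ν})^{N/2-k}` -/
def localC (l : Fin (ν + 1)) (k : Fin n) : Op (SysQ (2 * n) ν) :=
  strZlt (fstSite k) l * onQubit matX (fstSite k, l) * residualZ ν k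

/-- `d̃_{2k} = - Z_{2k-1,≤ν} Z_{2k,<ℓ} Y_{2k}^{(ℓ)} (Z_{2k-1,≤ν} Z_{2k,≤ν})^{N/2-k}` -/
def localD (l : Fin (ν + 1)) (k : Fin n) : Op (SysQ (2 * n) ν) :=
  -(strZall (fstSite k) * strZlt (sndSite k) l * onQubit matY (sndSite k, l) * residualZ ν k)

/-- The system qubits together with `n = N/2` ancilla qubits. -/
abbrev TotQ (n ν : ℕ) : Type := SysQ (2 * n) ν ⊕ Fin n

/-- A system operator tensored with the identity on the ancillas. -/
def sysOp (A : Op (SysQ (2 * n) ν)) : Op (TotQ n ν) :=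
  Matrix.of fun x y =>
    if ∀ k, x (Sum.inr k) = y (Sum.inr k) then A (x ∘ Sum.inl) (y ∘ Sum.inl) else 0

/-- `Ũ_k = |0⟩⟨0|_{anc,k} c̃_{2k-1} + |1⟩⟨1|_{anc,k} (-i d̃_{2k})` -/
def uLocal (l : Fin (ν + 1)) (k : Fin n) : Op (TotQ n ν) :=
  onQubit proj0 (Sum.inr k) * sysOp (localC l k) +
    onQubit proj1 (Sum.inr k) * sysOp ((-Complex.I) • localD l k)

/-- The qubits of the `k`-th pair of sites and the `k`-th ancilla. -/
def blockQubits (ν : ℕ) (k : Fin n) : Finset (TotQ n ν) :=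
  (pairQubits ν k).disjSum {k}

/-- `U_ord = ∏_k Ũ_k` -/
def uOrd (l : Fin (ν + 1)) : Op (TotQ n ν) := (List.ofFn fun k : Fin n => uLocal l k).prod

/-- A Hadamard on every ancilla. -/
def hadAnc (n ν : ℕ) : Op (TotQ n ν) :=
  (List.ofFn fun k : Fin n => onQubit matH (Sum.inr k : TotQ n ν)).prod

/-- The preparation unitary `H_anc U_ord H_anc`. -/
def uPrep (l : Fin (ν + 1)) : Op (TotQ n ν) := hadAnc n ν * uOrd l * hadAnc n ν

/-- `|0…0⟩_anc ⊗ ψ` -/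
def withZeroAnc (ψ : Ket (SysQ (2 * n) ν)) : Ket (TotQ n ν) :=
  fun x => if ∀ k, x (Sum.inr k) = 0 then ψ (x ∘ Sum.inl) else 0

/-- The unnormalized state of the system after the ancillas of `Φ` have been measured in the
computational basis with outcome `m`, i.e. `⟨m|_anc Φ`. -/
def afterOutcome (Φ : Ket (TotQ n ν)) (m : Fin n → Fin 2) : Ket (SysQ (2 * n) ν) :=
  fun s => Φ (Sum.elim s m)

/-- `∏_k (c_{2k-1} - (-1)^{m_k} i d_{2k})` -/
def signedProd (l : Fin (ν + 1)) (m : Fin n → Fin 2) : Op (SysQ (2 * n) ν) :=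
  (List.ofFn fun k : Fin n =>
    majC l (fstSite k) - ((-1 : ℂ) ^ (m k : ℕ) * Complex.I) • majD l (sndSite k)).prod

end Ordered

end OrderedPrep

end

open OrderedPrep

/-!
Every Jordan–Wigner string `S_{2k-1}` is the product of the strings `Z_{2j-1,≤ν} Z_{2j,≤ν}` of the
earlier pairs. Moving each of these strings onto its own pair turns the `k`-th factor into a local
operator times the residual power `N/2 - k` of the string of the pair.

A factor `c - i d` is the sum of the two unitaries `c` and `-i d`; an ancilla that selects one of
them between two Hadamard gates implements the sum or the difference, according to its measured
value. Since the Majorana operators anticommute and square to `1`, `i c d (c - i d) = c - i d`, and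
the stabilizers of distinct pairs commute with the other factors.

For the depth, `-i d̃` differs from `c̃` by a `Z`-string and two Pauli `X`, so each selected
operator consists of `O(1)` controlled Paulis and controlled `Z`-strings on at most `2(ν+1)` qubits.
A tree of CNOT gates collects the parity of `2 ^ d` qubits in depth `d`, after which one CZ gate
implements the controlled string. Distinct pairs run in parallel.
-/

namespace OrderedPrep

section Embedding

variable {R S Q : Type}

theorem eq_iff_agree_off_range (f : R → Q) (x y : Basis Q) :
    x = y ↔ (∀ q, (∀ r, f r ≠ q) → x q = y q) ∧ x ∘ f = y ∘ f := by
  refine ⟨fun h => by simp [h], fun ⟨hoff, hon⟩ => funext fun q => ?_⟩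
  by_cases hq : ∃ r, f r = q
  · obtain ⟨r, rfl⟩ := hq
    exact congr_fun hon r
  · exact hoff q (not_exists.mp hq)

variable [Fintype R] [Fintype Q] [DecidableEq Q]

theorem ite_agree_off_range_diagonal (f : R ↪ Q) (d : Basis R → ℂ) :
    (Matrix.of fun x y : Basis Q =>
      if ∀ q, (∀ r, f r ≠ q) → x q = y q then diagonal d (x ∘ f) (y ∘ f) else 0) =
      diagonal fun x => d (x ∘ f) := by
  ext x y
  simp only [Matrix.of_apply, diagonal_apply, ← ite_and, eq_iff_agree_off_range f x y]

variable [DecidableEq R]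

theorem sum_ite_agree_off_range {M : Type*} [AddCommMonoid M] (f : R ↪ Q) (x : Basis Q)
    (g : Basis Q → M) :
    (∑ z, if ∀ q, (∀ r, f r ≠ q) → x q = z q then g z else 0) =
      ∑ w : Basis R, g (Function.extend f w x) := by
  have hext : ∀ z : Basis Q, (∀ q, (∀ r, f r ≠ q) → x q = z q) →
      Function.extend f (z ∘ f) x = z := fun z hz =>
    (eq_iff_agree_off_range f _ _).2 ⟨fun q hq => by
      rw [Function.extend_apply' _ _ _ (not_exists.2 hq), hz q hq],
      Function.extend_comp f.injective _ _⟩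
  rw [← Finset.sum_filter]
  refine Finset.sum_bij' (fun z _ => z ∘ f) (fun w _ => Function.extend f w x) ?_ ?_ ?_ ?_ ?_
  · exact fun _ _ => Finset.mem_univ _
  · intro w _
    rw [Finset.mem_filter_univ]
    exact fun q hq => (Function.extend_apply' _ _ _ (not_exists.2 hq)).symm
  · exact fun z hz => hext z ((Finset.mem_filter_univ _).1 hz)
  · exact fun w _ => Function.extend_comp f.injective _ _
  · exact fun z hz => by rw [hext z ((Finset.mem_filter_univ _).1 hz)]

/-- The operator `A ⊗ 1` on the register `Q`, where `A` acts on the copy of the register `R`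
inside `Q` given by `f`. -/
noncomputable def embed (f : R ↪ Q) : Op R →⋆ₐ[ℂ] Op Q where
  toFun A := Matrix.of fun x y =>
    if ∀ q, (∀ r, f r ≠ q) → x q = y q then A (x ∘ f) (y ∘ f) else 0
  map_one' := by
    simp only [← diagonal_one]
    exact ite_agree_off_range_diagonal f _
  map_mul' A B := by
    ext x y
    have hoff : ∀ w : Basis R, (∀ q, (∀ r, f r ≠ q) → Function.extend f w x q = y q) ↔
        ∀ q, (∀ r, f r ≠ q) → x q = y q := fun w =>
      forall₂_congr fun q hq => by rw [Function.extend_apply' _ _ _ (not_exists.2 hq)]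
    have hsum := sum_ite_agree_off_range f x fun z => A (x ∘ f) (z ∘ f) *
      if ∀ q, (∀ r, f r ≠ q) → z q = y q then B (z ∘ f) (y ∘ f) else 0
    simp only [hoff, Function.extend_comp f.injective] at hsum
    simp only [Matrix.mul_apply, Matrix.of_apply, ite_mul, zero_mul, hsum]
    split_ifs <;> simp only [mul_zero, Finset.sum_const_zero]
  map_zero' := by ext; simp
  map_add' A B := by ext; simp [ite_add_ite]
  commutes' c := by
    simp only [Matrix.algebraMap_eq_diagonal]
    exact ite_agree_off_range_diagonal f _
  map_star' A := by
    ext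
    simp only [star_eq_conjTranspose, Matrix.of_apply, conjTranspose_apply, apply_ite star,
      star_zero, eq_comm]

theorem embed_apply (f : R ↪ Q) (A : Op R) (x y : Basis Q) :
    embed f A x y = if ∀ q, (∀ r, f r ≠ q) → x q = y q then A (x ∘ f) (y ∘ f) else 0 := rfl

theorem embed_diagonal (f : R ↪ Q) (d : Basis R → ℂ) :
    embed f (diagonal d) = diagonal fun x => d (x ∘ f) :=
  ite_agree_off_range_diagonal f d

variable [Fintype S] [DecidableEq S]

theorem embed_embed (f : R ↪ S) (g : S ↪ Q) (A : Op R) :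
    embed g (embed f A) = embed (f.trans g) A := by
  ext x y
  simp only [embed_apply, ← ite_and]
  refine if_congr ⟨fun ⟨hg, hf⟩ q hq => ?_, fun h => ⟨fun q hq => h q fun r => hq (f r),
    fun s hs => h (g s) fun r => g.injective.ne (hs r)⟩⟩ rfl rfl
  by_cases hs : ∃ s, g s = q
  · obtain ⟨s, rfl⟩ := hs
    exact hf s fun r hr => hq r (congr_arg g hr)
  · exact hg q (not_exists.1 hs)

theorem embed_mulVec_apply (f : R ↪ Q) (A : Op R) (v : Ket Q) (x : Basis Q) :
    (embed f A *ᵥ v) x = ∑ w, A (x ∘ f) w * v (Function.extend f w x) := by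
  have hsum := sum_ite_agree_off_range f x fun z => A (x ∘ f) (z ∘ f) * v z
  simp only [Function.extend_comp f.injective] at hsum
  simp only [Matrix.mulVec, dotProduct, embed_apply, ite_mul, zero_mul, hsum]

theorem embed_mul_apply (f : R ↪ Q) (A : Op R) (M : Op Q) (x y : Basis Q) :
    (embed f A * M) x y = ∑ w, A (x ∘ f) w * M (Function.extend f w x) y :=
  embed_mulVec_apply f A (fun z => M z y) x

end Embedding

section SingleQubit

variable {Q : Type} [Fintype Q] [DecidableEq Q]

/-- `onQubit · q` as a homomorphism of star algebras: the embedding of the register that consists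
of the qubit `q` alone. -/
noncomputable def singleQubit (q : Q) : Matrix (Fin 2) (Fin 2) ℂ →⋆ₐ[ℂ] Op Q :=
  (embed (Function.Embedding.punit.{1} q)).comp
    { (Matrix.reindexAlgEquiv ℂ ℂ (Equiv.funUnique Unit (Fin 2)).symm).toAlgHom with
      map_star' := fun A => (conjTranspose_reindex _ _ A).symm }

theorem onQubit_eq_embed (A : Matrix (Fin 2) (Fin 2) ℂ) (q : Q) :
    onQubit A q = embed (Function.Embedding.punit q) (A.submatrix (fun x : Basis Unit => x ())
      fun x => x ()) := by
  ext x y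
  exact if_congr (forall_congr' fun r => imp_congr_left ⟨fun h _ => h.symm, fun h => (h ()).symm⟩)
    rfl rfl

theorem singleQubit_apply (A : Matrix (Fin 2) (Fin 2) ℂ) (q : Q) :
    singleQubit q A = onQubit A q :=
  (onQubit_eq_embed A q).symm

theorem onQubit_one (q : Q) : onQubit 1 q = (1 : Op Q) := by
  rw [← singleQubit_apply, map_one]

theorem onQubit_mul (A B : Matrix (Fin 2) (Fin 2) ℂ) (q : Q) :
    onQubit (A * B) q = onQubit A q * onQubit B q := by
  simp only [← singleQubit_apply, map_mul]

theorem onQubit_add (A B : Matrix (Fin 2) (Fin 2) ℂ) (q : Q) :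
    onQubit (A + B) q = onQubit A q + onQubit B q := by
  simp only [← singleQubit_apply, map_add]

theorem onQubit_sub (A B : Matrix (Fin 2) (Fin 2) ℂ) (q : Q) :
    onQubit (A - B) q = onQubit A q - onQubit B q := by
  simp only [← singleQubit_apply, map_sub]

theorem onQubit_neg (A : Matrix (Fin 2) (Fin 2) ℂ) (q : Q) :
    onQubit (-A) q = -onQubit A q := by
  simp only [← singleQubit_apply, map_neg]

theorem onQubit_smul (a : ℂ) (A : Matrix (Fin 2) (Fin 2) ℂ) (q : Q) :
    onQubit (a • A) q = a • onQubit A q := by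
  simp only [← singleQubit_apply, map_smul]

theorem onQubit_conjTranspose (A : Matrix (Fin 2) (Fin 2) ℂ) (q : Q) :
    (onQubit A q)ᴴ = onQubit Aᴴ q := by
  simp only [← singleQubit_apply]
  exact (map_star (singleQubit q) A).symm

theorem onQubit_mem_unitaryGroup {A : Matrix (Fin 2) (Fin 2) ℂ}
    (hA : A ∈ unitaryGroup (Fin 2) ℂ) (q : Q) : onQubit A q ∈ unitaryGroup (Basis Q) ℂ := by
  rw [← singleQubit_apply]
  exact Unitary.map_mem (singleQubit q) hA

theorem onQubit_mulVec_apply (A : Matrix (Fin 2) (Fin 2) ℂ) (q : Q) (v : Ket Q) (x : Basis Q) :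
    (onQubit A q *ᵥ v) x = ∑ b, A (x q) b * v (Function.update x q b) := by
  rw [onQubit_eq_embed, embed_mulVec_apply]
  refine Fintype.sum_equiv (Equiv.funUnique Unit (Fin 2)) _ _ fun w =>
    congr_arg (A (x q) (w ()) * v ·) (funext fun r => ?_)
  by_cases hr : r = q
  · subst hr
    rw [Function.update_self]
    exact (Function.Embedding.punit r).injective.extend_apply w x ()
  · rw [Function.update_of_ne hr, Function.extend_apply' _ _ _ fun ⟨_, h⟩ => hr h.symm]

theorem embed_onQubit {R : Type} [Fintype R] [DecidableEq R] (f : R ↪ Q)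
    (A : Matrix (Fin 2) (Fin 2) ℂ) (r : R) : embed f (onQubit A r) = onQubit A (f r) := by
  rw [onQubit_eq_embed, embed_embed, onQubit_eq_embed]
  rfl

end SingleQubit

section LocalAlgebra

variable {R Q : Type} [Fintype R] [DecidableEq R] [Fintype Q] [DecidableEq Q]

/-- The star algebra `{B ⊗ 1}` of the operators supported on the qubits in `T`. -/
noncomputable def localAlgebra (T : Finset Q) : StarSubalgebra ℂ (Op Q) :=
  (embed (Function.Embedding.subtype (· ∈ T))).range

theorem mem_localAlgebra_iff_exists_embed {T : Finset Q} {A : Op Q} :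
    A ∈ localAlgebra T ↔ ∃ B, embed (Function.Embedding.subtype (· ∈ T)) B = A := Iff.rfl

theorem mem_localAlgebra_iff_supportedOn {T : Finset Q} {A : Op Q} :
    A ∈ localAlgebra T ↔ SupportedOn A T := by
  have hoff (q : Q) : (∀ r : {q // q ∈ T}, (r : Q) ≠ q) ↔ q ∉ T :=
    ⟨fun h hq => h ⟨q, hq⟩ rfl, fun h r hr => h (hr ▸ r.2)⟩
  refine mem_localAlgebra_iff_exists_embed.trans (exists_congr fun B => ?_)
  simp only [← Matrix.ext_iff, embed_apply, Function.Embedding.subtype_apply, hoff,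
    eq_comm (b := A _ _)]
  rfl

theorem embed_mem_localAlgebra {T : Finset Q} {f : R ↪ Q} (hf : ∀ r, f r ∈ T) (A : Op R) :
    embed f A ∈ localAlgebra T :=
  let e : R ↪ {q // q ∈ T} :=
    ⟨fun r => ⟨f r, hf r⟩, fun _ _ h => f.injective (congr_arg Subtype.val h)⟩
  mem_localAlgebra_iff_exists_embed.2 ⟨embed e A, embed_embed e _ A⟩

theorem embed_mem_localAlgebra_of_mem {A : Op R} {S : Finset R} {T : Finset Q} {f : R ↪ Q}
    (hf : ∀ r ∈ S, f r ∈ T) (hA : A ∈ localAlgebra S) : embed f A ∈ localAlgebra T := by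
  obtain ⟨B, rfl⟩ := mem_localAlgebra_iff_exists_embed.1 hA
  rw [embed_embed]
  exact embed_mem_localAlgebra (f := (Function.Embedding.subtype (· ∈ S)).trans f)
    (fun r => hf r r.2) B

theorem onQubit_mem_localAlgebra (A : Matrix (Fin 2) (Fin 2) ℂ) {q : Q} {T : Finset Q}
    (hq : q ∈ T) : onQubit A q ∈ localAlgebra T := by
  rw [onQubit_eq_embed]
  exact embed_mem_localAlgebra (fun _ => hq) _

theorem localAlgebra_mono {T T' : Finset Q} (h : T ⊆ T') :
    localAlgebra T ≤ localAlgebra T' := fun A hA => by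
  obtain ⟨B, rfl⟩ := mem_localAlgebra_iff_exists_embed.1 hA
  exact embed_mem_localAlgebra (fun r => h r.2) B

theorem weight_le_card {A : Op Q} {T : Finset Q} (hA : A ∈ localAlgebra T) :
    weight A ≤ T.card := by
  rw [weight, ← Set.ncard_coe_finset]
  refine Set.ncard_le_ncard (fun q hq => ?_) T.finite_toSet
  by_contra hqT
  exact hq (mem_localAlgebra_iff_supportedOn.1 (localAlgebra_mono (Finset.subset_erase.2
    ⟨Finset.subset_univ T, hqT⟩) hA))

theorem embed_mul_embed_apply {S : Type} [Fintype S] [DecidableEq S] {f : R ↪ Q} {g : S ↪ Q}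
    (hfg : ∀ r s, f r ≠ g s) (A : Op R) (B : Op S) (x y : Basis Q) :
    (embed f A * embed g B) x y = if ∀ q, (∀ r, f r ≠ q) → (∀ s, g s ≠ q) → x q = y q
      then A (x ∘ f) (y ∘ f) * B (x ∘ g) (y ∘ g) else 0 := by
  have hg (w : Basis R) : Function.extend f w x ∘ g = x ∘ g := funext fun s =>
    Function.extend_apply' _ _ _ fun ⟨r, hr⟩ => hfg r s hr
  have hoff (w : Basis R) : (∀ q, (∀ s, g s ≠ q) → Function.extend f w x q = y q) ↔
      w = y ∘ f ∧ ∀ q, (∀ r, f r ≠ q) → (∀ s, g s ≠ q) → x q = y q := by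
    refine ⟨fun h => ⟨funext fun r => ?_, fun q hf hg => ?_⟩, ?_⟩
    · rw [← f.injective.extend_apply w x r]
      exact h (f r) fun s => (hfg r s).symm
    · rw [← Function.extend_apply' w x q (not_exists.2 hf)]
      exact h q hg
    · rintro ⟨rfl, h⟩ q hg
      by_cases hf : ∃ r, f r = q
      · obtain ⟨r, rfl⟩ := hf
        exact f.injective.extend_apply _ _ _
      · rw [Function.extend_apply' _ _ _ hf]
        exact h q (not_exists.1 hf) hg
  simp only [embed_mul_apply, embed_apply, hg, hoff, ite_and, mul_ite, mul_zero,
    Finset.sum_ite_eq', Finset.mem_univ, if_true]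

theorem commute_embed_embed {S : Type} [Fintype S] [DecidableEq S] {f : R ↪ Q} {g : S ↪ Q}
    (hfg : ∀ r s, f r ≠ g s) (A : Op R) (B : Op S) : Commute (embed f A) (embed g B) := by
  ext x y
  rw [embed_mul_embed_apply hfg, embed_mul_embed_apply fun s r => (hfg r s).symm, mul_comm]
  exact if_congr (forall_congr' fun q => forall_comm) rfl rfl

theorem commute_of_mem_localAlgebra {A B : Op Q} {T T' : Finset Q} (hT : Disjoint T T')
    (hA : A ∈ localAlgebra T) (hB : B ∈ localAlgebra T') : Commute A B := by
  obtain ⟨A, rfl⟩ := mem_localAlgebra_iff_exists_embed.1 hA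
  obtain ⟨B, rfl⟩ := mem_localAlgebra_iff_exists_embed.1 hB
  exact commute_embed_embed (f := Function.Embedding.subtype (· ∈ T))
    (g := Function.Embedding.subtype (· ∈ T'))
    (fun r s => Finset.disjoint_iff_ne.1 hT r r.2 s s.2) A B

theorem commute_onQubit_onQubit (A B : Matrix (Fin 2) (Fin 2) ℂ) {q r : Q} (h : q ≠ r) :
    Commute (onQubit A q) (onQubit B r) :=
  commute_of_mem_localAlgebra (Finset.disjoint_singleton.2 h)
    (onQubit_mem_localAlgebra A (Finset.mem_singleton_self q))
    (onQubit_mem_localAlgebra B (Finset.mem_singleton_self r))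

end LocalAlgebra

section PauliMatrices

theorem matX_conjTranspose : matXᴴ = matX := by
  ext i j; fin_cases i <;> fin_cases j <;> simp [matX]

theorem matY_conjTranspose : matYᴴ = matY := by
  ext i j; fin_cases i <;> fin_cases j <;> simp [matY]

theorem matH_conjTranspose : matHᴴ = matH := by
  ext i j; fin_cases i <;> fin_cases j <;> simp [matH]

theorem proj0_conjTranspose : proj0ᴴ = proj0 := by
  ext i j; fin_cases i <;> fin_cases j <;> simp [proj0]

theorem proj1_conjTranspose : proj1ᴴ = proj1 := by
  ext i j; fin_cases i <;> fin_cases j <;> simp [proj1]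

theorem matX_mul_self : matX * matX = 1 := by
  simp [matX, Matrix.one_fin_two]

theorem matY_mul_self : matY * matY = 1 := by
  simp [matY, Matrix.one_fin_two]

theorem matZ_mul_matX : matZ * matX = -(matX * matZ) := by
  ext i j; fin_cases i <;> fin_cases j <;> simp [matX, matZ]

theorem I_smul_matY : Complex.I • matY = matZ * matX := by
  ext i j; fin_cases i <;> fin_cases j <;> simp [matX, matY, matZ]

theorem inv_sqrt_two_mul_self :
    ((Real.sqrt 2 : ℝ) : ℂ)⁻¹ * ((Real.sqrt 2 : ℝ) : ℂ)⁻¹ = 2⁻¹ := by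
  rw [← mul_inv, ← Complex.ofReal_mul, Real.mul_self_sqrt (by norm_num)]
  simp

theorem matH_mul_self : matH * matH = 1 := by
  rw [matH, smul_mul_smul_comm, inv_sqrt_two_mul_self]
  ext i j; fin_cases i <;> fin_cases j <;> norm_num

theorem matH_mul_matX_mul_matH : matH * matX * matH = matZ := by
  rw [matH, smul_mul_assoc, smul_mul_smul_comm, inv_sqrt_two_mul_self]
  ext i j; fin_cases i <;> fin_cases j <;> norm_num [matX, matZ]

theorem proj0_add_proj1 : proj0 + proj1 = 1 := by
  simp [proj0, proj1, Matrix.one_fin_two]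

theorem proj0_sub_proj1 : proj0 - proj1 = matZ := by
  ext i j; fin_cases i <;> fin_cases j <;> simp [proj0, proj1, matZ]

theorem proj0_mul_self : proj0 * proj0 = proj0 := by
  ext i j; fin_cases i <;> fin_cases j <;> simp [proj0]

theorem proj1_mul_self : proj1 * proj1 = proj1 := by
  ext i j; fin_cases i <;> fin_cases j <;> simp [proj1]

theorem proj0_mul_proj1 : proj0 * proj1 = 0 := by
  ext i j; fin_cases i <;> fin_cases j <;> simp [proj0, proj1]

theorem proj1_mul_proj0 : proj1 * proj0 = 0 := by
  ext i j; fin_cases i <;> fin_cases j <;> simp [proj0, proj1]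

theorem matX_mul_proj0 : matX * proj0 = proj1 * matX := by
  ext i j; fin_cases i <;> fin_cases j <;> simp [proj0, proj1, matX]

theorem matX_mul_proj1 : matX * proj1 = proj0 * matX := by
  ext i j; fin_cases i <;> fin_cases j <;> simp [proj0, proj1, matX]

end PauliMatrices

section ZStrings

variable {R Q : Type} [Fintype R] [DecidableEq R] [Fintype Q] [DecidableEq Q]

theorem onQubit_matZ_eq_diagonal (q : Q) :
    onQubit matZ q = diagonal fun x : Basis Q => (-1 : ℂ) ^ (x q : ℕ) := by
  have hZ : matZ.submatrix (fun x : Basis Unit => x ()) (fun x => x ()) =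
      diagonal fun x => (-1 : ℂ) ^ (x () : ℕ) := by
    have h : matZ = diagonal fun b : Fin 2 => (-1 : ℂ) ^ (b : ℕ) := by
      ext i j; fin_cases i <;> fin_cases j <;> simp [matZ]
    rw [h]
    exact submatrix_diagonal _ _ (Equiv.funUnique Unit (Fin 2)).injective
  rw [onQubit_eq_embed, hZ, embed_diagonal]
  rfl

theorem zString_eq_diagonal (T : Finset Q) :
    zString T = diagonal (∏ q ∈ T, fun x : Basis Q => (-1 : ℂ) ^ (x q : ℕ)) := by
  rw [zString, ← Finset.prod_map_toList, ← diagonalRingHom_apply, map_list_prod, List.map_map]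
  simp only [onQubit_matZ_eq_diagonal]
  rfl

theorem zString_empty : zString (∅ : Finset Q) = 1 := by simp [zString]

theorem zString_singleton (q : Q) : zString {q} = onQubit matZ q := by simp [zString]

theorem zString_union {S T : Finset Q} (h : Disjoint S T) :
    zString (S ∪ T) = zString S * zString T := by
  simp only [zString_eq_diagonal, Finset.prod_union h]
  exact map_mul (diagonalRingHom (Basis Q) ℂ) _ _

theorem zString_insert {q : Q} {T : Finset Q} (h : q ∉ T) :
    zString (insert q T) = onQubit matZ q * zString T := by
  rw [Finset.insert_eq, zString_union (Finset.disjoint_singleton_left.2 h), zString_singleton]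

theorem zString_filter_or (p r : Q → Prop) [DecidablePred p] [DecidablePred r]
    (h : ∀ q, p q → ¬ r q) :
    zString (Finset.univ.filter fun q => p q ∨ r q) =
      zString (Finset.univ.filter p) * zString (Finset.univ.filter r) := by
  rw [Finset.filter_or, zString_union (Finset.disjoint_filter.2 fun q _ => h q)]

theorem embed_zString (f : R ↪ Q) (T : Finset R) : embed f (zString T) = zString (T.map f) := by
  simp only [zString_eq_diagonal, embed_diagonal, Finset.prod_map, Finset.prod_fn,
    Function.comp_apply]

theorem zString_mem_localAlgebra {S T : Finset Q} (h : S ⊆ T) : zString S ∈ localAlgebra T :=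
  list_prod_mem <| List.forall_mem_map.2 fun _ hq =>
    onQubit_mem_localAlgebra _ (h (Finset.mem_toList.1 hq))

theorem zString_mul_self (T : Finset Q) : zString T * zString T = 1 := by
  have hsign (q : Q) :
      ((fun x : Basis Q => (-1 : ℂ) ^ (x q : ℕ)) * fun x => (-1) ^ (x q : ℕ)) = 1 :=
    funext fun x => by rw [Pi.mul_apply, ← mul_pow, neg_one_mul, neg_neg, one_pow, Pi.one_apply]
  rw [zString_eq_diagonal, ← diagonalRingHom_apply, ← map_mul, ← Finset.prod_mul_distrib,
    Finset.prod_congr rfl fun q _ => hsign q, Finset.prod_const_one, map_one]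

theorem commute_zString_zString (S T : Finset Q) : Commute (zString S) (zString T) := by
  rw [zString_eq_diagonal, zString_eq_diagonal]
  exact commute_diagonal _ _

theorem zString_conjTranspose (T : Finset Q) : (zString T)ᴴ = zString T := by
  have hsign (q : Q) : star (fun x : Basis Q => (-1 : ℂ) ^ (x q : ℕ)) = fun x => (-1) ^ (x q : ℕ) :=
    funext fun x => by rw [Pi.star_apply, star_pow, star_neg, star_one]
  rw [zString_eq_diagonal, diagonal_conjTranspose, star_prod,
    Finset.prod_congr rfl fun q _ => hsign q]

theorem zString_mem_unitaryGroup (T : Finset Q) : zString T ∈ unitaryGroup (Basis Q) ℂ := by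
  rw [mem_unitaryGroup_iff, star_eq_conjTranspose, zString_conjTranspose, zString_mul_self]

theorem commute_zString_onQubit (A : Matrix (Fin 2) (Fin 2) ℂ) {q : Q} {T : Finset Q}
    (h : q ∉ T) : Commute (zString T) (onQubit A q) :=
  commute_of_mem_localAlgebra (Finset.disjoint_singleton_right.2 h)
    (zString_mem_localAlgebra subset_rfl) (onQubit_mem_localAlgebra A (Finset.mem_singleton_self q))

theorem zString_mul_onQubit_of_mem {A : Matrix (Fin 2) (Fin 2) ℂ} (hA : matZ * A = -(A * matZ))
    {q : Q} {T : Finset Q} (h : q ∈ T) :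
    zString T * onQubit A q = -(onQubit A q * zString T) := by
  have hT : zString T = onQubit matZ q * zString (T.erase q) := by
    rw [← zString_insert (Finset.notMem_erase q T), Finset.insert_erase h]
  calc zString T * onQubit A q = onQubit (matZ * A) q * zString (T.erase q) := by
        rw [hT, mul_assoc, (commute_zString_onQubit A (Finset.notMem_erase q T)).eq, ← mul_assoc,
          onQubit_mul]
    _ = -(onQubit A q * zString T) := by
        rw [hA, onQubit_neg, onQubit_mul, neg_mul, mul_assoc, hT]

theorem conjTranspose_zString_mul_onQubit (A : Matrix (Fin 2) (Fin 2) ℂ) {q : Q} {T : Finset Q}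
    (h : q ∉ T) : (zString T * onQubit A q)ᴴ = zString T * onQubit Aᴴ q := by
  rw [conjTranspose_mul, zString_conjTranspose, onQubit_conjTranspose,
    (commute_zString_onQubit Aᴴ h).eq]

theorem zString_mul_onQubit_mul_self {A : Matrix (Fin 2) (Fin 2) ℂ} (hA : A * A = 1) {q : Q}
    {T : Finset Q} (h : q ∉ T) :
    (zString T * onQubit A q) * (zString T * onQubit A q) = 1 := by
  rw [(commute_zString_onQubit A h).symm.mul_mul_mul_comm, zString_mul_self, ← onQubit_mul, hA,
    onQubit_one, mul_one]

theorem zString_mul_onQubit_anticommute {A : Matrix (Fin 2) (Fin 2) ℂ}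
    (hA : matZ * A = -(A * matZ)) (B : Matrix (Fin 2) (Fin 2) ℂ) {q r : Q} (hqr : q ≠ r)
    {S T : Finset Q} (hr : r ∉ S) (hq : q ∈ T) :
    (zString S * onQubit A q) * (zString T * onQubit B r) =
      -((zString T * onQubit B r) * (zString S * onQubit A q)) := by
  have hB : Commute (zString S * onQubit A q) (onQubit B r) :=
    (commute_zString_onQubit B hr).mul_left (commute_onQubit_onQubit A B hqr)
  have hT : zString S * onQubit A q * zString T = -(zString T * (zString S * onQubit A q)) := by
    rw [← mul_assoc, (commute_zString_zString T S).eq, mul_assoc _ (zString T),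
      zString_mul_onQubit_of_mem hA hq, mul_neg, neg_neg, mul_assoc]
  rw [← mul_assoc, hT, neg_mul, mul_assoc, hB.eq, ← mul_assoc]

end ZStrings

section OrderedProducts

variable {M : Type*} [Monoid M]

theorem prod_map_mul_prod_map {ι : Type*} {f g : ι → M}
    (h : ∀ i j, i ≠ j → Commute (f i) (g j)) {L : List ι} (hL : L.Nodup) :
    (L.map f).prod * (L.map g).prod = (L.map fun i => f i * g i).prod := by
  induction L with
  | nil => simp
  | cons i L ih =>
    obtain ⟨hi, hL⟩ := List.nodup_cons.1 hL
    have hc : Commute (L.map f).prod (g i) :=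
      Commute.list_prod_left _ _ <| List.forall_mem_map.2 fun j hj =>
        h j i (ne_of_mem_of_not_mem hj hi)
    simp only [List.map_cons, List.prod_cons]
    rw [← ih hL, hc.mul_mul_mul_comm]

theorem prod_ofFn_mul_prod_ofFn {n : ℕ} {f g : Fin n → M}
    (h : ∀ i j, i ≠ j → Commute (f i) (g j)) :
    (List.ofFn f).prod * (List.ofFn g).prod = (List.ofFn fun i => f i * g i).prod := by
  simp only [List.ofFn_eq_map]
  exact prod_map_mul_prod_map h (List.nodup_finRange n)

theorem pow_mul_prod_ofFn {n : ℕ} {a : M} {f : Fin n → M} (h : ∀ i, Commute a (f i)) :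
    a ^ n * (List.ofFn f).prod = (List.ofFn fun i => a * f i).prod := by
  rw [← prod_ofFn_mul_prod_ofFn fun _ j _ => h j, List.ofFn_const, List.prod_replicate]

/-- The idea behind locality: in an ordered product whose `k`-th factor carries the string
`∏_{j < k} P j`, each `P j` can be moved to the position `j`, where it occurs once for every later
factor. -/
theorem prod_ofFn_string {n : ℕ} (A P : Fin n → M) (hA : ∀ i j, i ≠ j → Commute (P i) (A j))
    (hP : ∀ i j, Commute (P i) (P j)) :
    (List.ofFn fun k : Fin n => ((List.ofFn P).take k).prod * A k).prod =
      (List.ofFn fun k : Fin n => A k * P k ^ (n - (k + 1))).prod := by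
  induction n with
  | zero => simp
  | succ n ih =>
    have hcomm (k : Fin n) : Commute (P 0)
        (((List.ofFn fun j : Fin n => P j.succ).take k).prod * A k.succ) := by
      refine Commute.mul_right (Commute.list_prod_right _ _ fun p hp => ?_)
        (hA _ _ (Fin.succ_ne_zero k).symm)
      obtain ⟨j, rfl⟩ := List.mem_ofFn.1 (List.mem_of_mem_take hp)
      exact hP _ _
    have htail := ih (fun k => A k.succ) (fun k => P k.succ)
      (fun i j hij => hA _ _ ((Fin.succ_injective n).ne hij)) fun i j => hP _ _
    simp only [List.ofFn_succ, List.prod_cons, Fin.val_zero, List.take_zero, List.prod_nil,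
      one_mul, Fin.val_succ, List.take_succ_cons, mul_assoc, ← pow_mul_prod_ofFn hcomm, htail,
      Nat.sub_zero, Nat.add_sub_add_right]

theorem mul_prod_ofFn_eq_of_mul_eq {n : ℕ} {f : Fin n → M} {g : M} {k : Fin n}
    (hk : g * f k = f k) (h : ∀ j, j ≠ k → Commute g (f j)) :
    g * (List.ofFn f).prod = (List.ofFn f).prod := by
  induction n with
  | zero => exact k.elim0
  | succ n ih =>
    rw [List.ofFn_succ, List.prod_cons]
    by_cases hj : k = 0
    · rw [← mul_assoc, ← hj, hk]
    · obtain ⟨i, rfl⟩ := Fin.exists_succ_eq.2 hj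
      rw [← mul_assoc, (h 0 (Fin.succ_ne_zero i).symm).eq, mul_assoc,
        ih hk fun j hji => h _ ((Fin.succ_injective n).ne hji)]

end OrderedProducts

section JordanWigner

variable {N n ν : ℕ}

theorem strS_mul_strZlt (i : Fin N) (l : Fin (ν + 1)) :
    strS i * strZlt i l =
      zString (Finset.univ.filter fun q : SysQ N ν => q.1 < i ∨ q.1 = i ∧ q.2 < l) :=
  (zString_filter_or _ _ fun _ hlt heq => hlt.ne heq.1).symm

theorem modeB_eq (l : Fin (ν + 1)) (i : Fin N) :
    (modeB l i : Op (SysQ N ν)) =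
      strS i * strZlt i l * onQubit ((2 : ℂ)⁻¹ • (matX - Complex.I • matY)) (i, l) := by
  rw [modeB, onQubit_smul, onQubit_sub, onQubit_smul]

theorem modeB_conjTranspose (l : Fin (ν + 1)) (i : Fin N) :
    (modeB l i : Op (SysQ N ν))ᴴ =
      strS i * strZlt i l * onQubit ((2 : ℂ)⁻¹ • (matX + Complex.I • matY)) (i, l) := by
  have hσ : ((2 : ℂ)⁻¹ • (matX - Complex.I • matY))ᴴ = (2 : ℂ)⁻¹ • (matX + Complex.I • matY) := by
    simp [conjTranspose_smul, matX_conjTranspose, matY_conjTranspose]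
  rw [modeB_eq, strS_mul_strZlt, conjTranspose_zString_mul_onQubit _ (by simp), hσ]

theorem majC_eq (l : Fin (ν + 1)) (i : Fin N) :
    (majC l i : Op (SysQ N ν)) = strS i * strZlt i l * onQubit matX (i, l) := by
  rw [majC, modeB_conjTranspose, modeB_eq, ← mul_add, ← onQubit_add]
  congr 2
  module

theorem majD_eq (l : Fin (ν + 1)) (i : Fin N) :
    (majD l i : Op (SysQ N ν)) = -(strS i * strZlt i l * onQubit matY (i, l)) := by
  rw [majD, modeB_conjTranspose, modeB_eq, ← mul_sub, ← onQubit_sub, ← mul_smul_comm,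
    ← onQubit_smul, ← mul_neg, ← onQubit_neg]
  have hY : (2 : ℂ)⁻¹ • (matX - Complex.I • matY) - (2 : ℂ)⁻¹ • (matX + Complex.I • matY) =
      (-Complex.I) • matY := by
    module
  rw [hY, smul_smul, neg_mul_neg, Complex.I_mul_I, neg_one_smul]

theorem fstSite_val (k : Fin n) : (fstSite k : ℕ) = 2 * k := rfl

theorem sndSite_val (k : Fin n) : (sndSite k : ℕ) = 2 * k + 1 := rfl

theorem fstSite_ne_sndSite (k : Fin n) : fstSite k ≠ sndSite k :=
  Fin.ne_of_val_ne (Nat.succ_ne_self _).symm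

theorem mem_pairQubits {k : Fin n} {q : SysQ (2 * n) ν} :
    q ∈ pairQubits ν k ↔ q.1 = fstSite k ∨ q.1 = sndSite k :=
  Finset.mem_filter_univ q

theorem disjoint_pairQubits {k k' : Fin n} (h : k ≠ k') :
    Disjoint (pairQubits ν k) (pairQubits ν k') := by
  refine Finset.disjoint_left.2 fun q h1 h2 => h (Fin.ext ?_)
  simp only [mem_pairQubits, Fin.ext_iff, fstSite_val, sndSite_val] at h1 h2
  omega

theorem card_pairQubits (k : Fin n) : (pairQubits ν k).card = 2 * (ν + 1) := by
  have hprod : pairQubits ν k =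
      ({fstSite k, sndSite k} : Finset (Fin (2 * n))) ×ˢ Finset.univ := by
    ext q
    simp [mem_pairQubits]
  rw [hprod, Finset.card_product, Finset.card_pair (fstSite_ne_sndSite k), Finset.card_univ,
    Fintype.card_fin]

theorem strZall_mul_strZall (k : Fin n) :
    (strZall (fstSite k) * strZall (sndSite k) : Op (SysQ (2 * n) ν)) =
      zString (pairQubits ν k) :=
  (zString_filter_or _ _ fun _ h1 h2 => fstSite_ne_sndSite k (h1.symm.trans h2)).symm

theorem strS_sndSite (k : Fin n) :
    (strS (sndSite k) : Op (SysQ (2 * n) ν)) = strS (fstSite k) * strZall (fstSite k) := by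
  rw [strS, strS, strZall, ← zString_filter_or _ _ fun _ hlt heq => hlt.ne heq]
  congr 1
  ext q
  simp only [Finset.mem_filter_univ, Fin.lt_def, Fin.ext_iff, fstSite_val, sndSite_val]
  omega

theorem prod_take_zString_pairQubits {m : ℕ} (hm : m ≤ n) :
    ((List.ofFn fun j : Fin n => zString (pairQubits ν j)).take m).prod =
      zString (Finset.univ.filter fun q : SysQ (2 * n) ν => (q.1 : ℕ) < 2 * m) := by
  induction m with
  | zero => simp [zString_empty]
  | succ m ih =>
    rw [List.prod_take_succ _ m (by simpa using hm), ih (by omega), List.getElem_ofFn, pairQubits,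
      ← zString_filter_or]
    · congr 1
      ext q
      simp only [Finset.mem_filter_univ, Fin.ext_iff, fstSite_val, sndSite_val]
      omega
    · simp only [Fin.ext_iff, fstSite_val, sndSite_val]
      omega

theorem strS_fstSite (k : Fin n) :
    strS (fstSite k) = ((List.ofFn fun j : Fin n => zString (pairQubits ν j)).take k).prod :=
  (prod_take_zString_pairQubits k.2.le).symm

theorem residualZ_eq (k : Fin n) :
    residualZ ν k = zString (pairQubits ν k) ^ (n - (k + 1)) := by
  rw [residualZ, strZall_mul_strZall]

end JordanWigner

section Pairs

variable {n ν : ℕ}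

/-- The Jordan–Wigner string of `c_{2k-1}` inside the `k`-th pair of sites. -/
def stringC (l : Fin (ν + 1)) (k : Fin n) : Finset (SysQ (2 * n) ν) :=
  Finset.univ.filter fun q => q.1 = fstSite k ∧ q.2 < l

/-- The Jordan–Wigner string of `d_{2k}` inside the `k`-th pair of sites. -/
def stringD (l : Fin (ν + 1)) (k : Fin n) : Finset (SysQ (2 * n) ν) :=
  Finset.univ.filter fun q => q.1 = fstSite k ∨ q.1 = sndSite k ∧ q.2 < l

/-- The Majorana operator `c_{2k-1}` of a chain that starts at the `k`-th pair of sites: it is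
`c_{2k-1}` without the string `S_{2k-1}` of the earlier pairs. -/
noncomputable def pairC (l : Fin (ν + 1)) (k : Fin n) : Op (SysQ (2 * n) ν) :=
  zString (stringC l k) * onQubit matX (fstSite k, l)

/-- The Majorana operator `d_{2k}` of a chain that starts at the `k`-th pair of sites: it is
`d_{2k}` without the string `S_{2k-1}` of the earlier pairs. -/
noncomputable def pairD (l : Fin (ν + 1)) (k : Fin n) : Op (SysQ (2 * n) ν) :=
  -(zString (stringD l k) * onQubit matY (sndSite k, l))

theorem fst_notMem_stringC (l : Fin (ν + 1)) (k : Fin n) : (fstSite k, l) ∉ stringC l k := by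
  simp [stringC]

theorem snd_notMem_stringC (l : Fin (ν + 1)) (k : Fin n) : (sndSite k, l) ∉ stringC l k := by
  simp [stringC]

theorem fst_mem_stringD (l : Fin (ν + 1)) (k : Fin n) : (fstSite k, l) ∈ stringD l k := by
  simp [stringD]

theorem snd_notMem_stringD (l : Fin (ν + 1)) (k : Fin n) : (sndSite k, l) ∉ stringD l k := by
  simp [stringD, (fstSite_ne_sndSite k).symm]

theorem stringC_subset (l : Fin (ν + 1)) (k : Fin n) : stringC l k ⊆ pairQubits ν k :=
  Finset.monotone_filter_right _ fun _ _ h => Or.inl h.1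

theorem stringD_subset (l : Fin (ν + 1)) (k : Fin n) : stringD l k ⊆ pairQubits ν k :=
  Finset.monotone_filter_right _ fun _ _ h => h.imp_right And.left

theorem strZall_mul_strZlt (l : Fin (ν + 1)) (k : Fin n) :
    strZall (fstSite k) * strZlt (sndSite k) l = zString (stringD l k) :=
  (zString_filter_or _ _ fun _ h1 h2 => fstSite_ne_sndSite k (h1.symm.trans h2.1)).symm

theorem majC_fstSite (l : Fin (ν + 1)) (k : Fin n) :
    majC l (fstSite k) = strS (fstSite k) * pairC l k := by
  rw [majC_eq, mul_assoc]
  rfl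

theorem majD_sndSite (l : Fin (ν + 1)) (k : Fin n) :
    majD l (sndSite k) = strS (fstSite k) * pairD l k := by
  rw [majD_eq, strS_sndSite, mul_assoc (strS _), strZall_mul_strZlt, mul_assoc, ← mul_neg, pairD]

theorem majC_sub_smul_majD (l : Fin (ν + 1)) (k : Fin n) (a : ℂ) :
    majC l (fstSite k) - a • majD l (sndSite k) =
      strS (fstSite k) * (pairC l k - a • pairD l k) := by
  rw [majC_fstSite, majD_sndSite, ← mul_smul_comm, ← mul_sub]

theorem localC_eq (l : Fin (ν + 1)) (k : Fin n) : localC l k = pairC l k * residualZ ν k := rfl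

theorem localD_eq (l : Fin (ν + 1)) (k : Fin n) : localD l k = pairD l k * residualZ ν k := by
  rw [localD, strZall_mul_strZlt, pairD, neg_mul]

theorem localC_sub_smul_localD (l : Fin (ν + 1)) (k : Fin n) (a : ℂ) :
    localC l k - a • localD l k = (pairC l k - a • pairD l k) * residualZ ν k := by
  rw [localC_eq, localD_eq, ← smul_mul_assoc, ← sub_mul]

theorem pairC_mem_localAlgebra (l : Fin (ν + 1)) (k : Fin n) :
    pairC l k ∈ localAlgebra (pairQubits ν k) :=
  mul_mem (zString_mem_localAlgebra (stringC_subset l k))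
    (onQubit_mem_localAlgebra _ (mem_pairQubits.2 (Or.inl rfl)))

theorem pairD_mem_localAlgebra (l : Fin (ν + 1)) (k : Fin n) :
    pairD l k ∈ localAlgebra (pairQubits ν k) :=
  neg_mem <| mul_mem (zString_mem_localAlgebra (stringD_subset l k))
    (onQubit_mem_localAlgebra _ (mem_pairQubits.2 (Or.inr rfl)))

theorem residualZ_mem_localAlgebra (k : Fin n) :
    residualZ ν k ∈ localAlgebra (pairQubits ν k) := by
  rw [residualZ_eq]
  exact pow_mem (zString_mem_localAlgebra subset_rfl) _

theorem localC_mem_localAlgebra (l : Fin (ν + 1)) (k : Fin n) :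
    localC l k ∈ localAlgebra (pairQubits ν k) :=
  mul_mem (pairC_mem_localAlgebra l k) (residualZ_mem_localAlgebra k)

theorem localD_mem_localAlgebra (l : Fin (ν + 1)) (k : Fin n) :
    localD l k ∈ localAlgebra (pairQubits ν k) := by
  rw [localD_eq]
  exact mul_mem (pairD_mem_localAlgebra l k) (residualZ_mem_localAlgebra k)

theorem pairC_mul_self (l : Fin (ν + 1)) (k : Fin n) : pairC l k * pairC l k = 1 :=
  zString_mul_onQubit_mul_self matX_mul_self (fst_notMem_stringC l k)

theorem pairD_mul_self (l : Fin (ν + 1)) (k : Fin n) : pairD l k * pairD l k = 1 := by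
  rw [pairD, neg_mul_neg, zString_mul_onQubit_mul_self matY_mul_self (snd_notMem_stringD l k)]

theorem pairC_mul_pairD (l : Fin (ν + 1)) (k : Fin n) :
    pairC l k * pairD l k = -(pairD l k * pairC l k) := by
  have hne : ((fstSite k, l) : SysQ (2 * n) ν) ≠ (sndSite k, l) := fun h =>
    fstSite_ne_sndSite k (congr_arg Prod.fst h)
  rw [pairC, pairD, mul_neg, neg_mul, zString_mul_onQubit_anticommute matZ_mul_matX matY hne
    (snd_notMem_stringC l k) (fst_mem_stringD l k)]

theorem stab_eq (l : Fin (ν + 1)) (k : Fin n) :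
    stab l (fstSite k) (sndSite k) = Complex.I • (pairC l k * pairD l k) := by
  have hcomm : Commute (strS (fstSite k)) (pairC l k) :=
    (commute_zString_zString _ _).mul_right (commute_zString_onQubit _ (by simp))
  rw [stab, majC_fstSite, majD_sndSite, hcomm.eq, mul_assoc, ← mul_assoc (strS _), strS,
    zString_mul_self, one_mul]

theorem signedProd_eq (l : Fin (ν + 1)) (m : Fin n → Fin 2) :
    signedProd l m = (List.ofFn fun k : Fin n =>
      localC l k - ((-1 : ℂ) ^ (m k : ℕ) * Complex.I) • localD l k).prod := by
  have hlocal (k : Fin n) : pairC l k - ((-1 : ℂ) ^ (m k : ℕ) * Complex.I) • pairD l k ∈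
      localAlgebra (pairQubits ν k) :=
    sub_mem (pairC_mem_localAlgebra l k) (SMulMemClass.smul_mem _ (pairD_mem_localAlgebra l k))
  simp only [signedProd, majC_sub_smul_majD, localC_sub_smul_localD, strS_fstSite, residualZ_eq]
  exact prod_ofFn_string _ _
    (fun i j hij => commute_of_mem_localAlgebra (disjoint_pairQubits hij)
      (zString_mem_localAlgebra subset_rfl) (hlocal j))
    fun i j => commute_zString_zString _ _

theorem smul_I_mul_mul_sub {A : Type*} [Ring A] [Algebra ℂ A] {c d : A} {s : ℂ} (hs : s * s = 1)
    (hc : c * c = 1) (hd : d * d = 1) (hcd : c * d = -(d * c)) :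
    (s • Complex.I • (c * d)) * (c - (s * Complex.I) • d) = c - (s * Complex.I) • d := by
  have hcdc : c * d * c = -d := by rw [hcd, neg_mul, mul_assoc, hc, mul_one]
  have hcdd : c * d * d = c := by rw [mul_assoc, hd, mul_one]
  have hsI : s * Complex.I * (s * Complex.I) = -1 := by
    rw [mul_mul_mul_comm, hs, Complex.I_mul_I, one_mul]
  rw [smul_smul, smul_mul_assoc, mul_sub, mul_smul_comm, hcdc, hcdd, smul_sub, smul_smul, hsI,
    smul_neg, neg_one_smul, sub_neg_eq_add, neg_add_eq_sub]

theorem smul_stab_mul_signedProd (l : Fin (ν + 1)) (m : Fin n → Fin 2) (k : Fin n) :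
    ((-1 : ℂ) ^ (m k : ℕ) • stab l (fstSite k) (sndSite k)) * signedProd l m =
      signedProd l m := by
  have hsign : (-1 : ℂ) ^ (m k : ℕ) * (-1) ^ (m k : ℕ) = 1 := by
    rw [← mul_pow, neg_one_mul, neg_neg, one_pow]
  have hstab : (-1 : ℂ) ^ (m k : ℕ) • Complex.I • (pairC l k * pairD l k) ∈
      localAlgebra (pairQubits ν k) :=
    SMulMemClass.smul_mem _ <| SMulMemClass.smul_mem _ <|
      mul_mem (pairC_mem_localAlgebra l k) (pairD_mem_localAlgebra l k)
  rw [stab_eq, signedProd_eq]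
  refine mul_prod_ofFn_eq_of_mul_eq (k := k) ?_ fun j hjk => ?_
  · rw [localC_sub_smul_localD, ← mul_assoc,
      smul_I_mul_mul_sub hsign (pairC_mul_self l k) (pairD_mul_self l k) (pairC_mul_pairD l k)]
  · exact commute_of_mem_localAlgebra (disjoint_pairQubits hjk.symm) hstab <|
      sub_mem (localC_mem_localAlgebra l j) (SMulMemClass.smul_mem _ (localD_mem_localAlgebra l j))

theorem cOrd_eq_signedProd (l : Fin (ν + 1)) :
    (cOrd l : Op (SysQ (2 * n) ν)) =
      (((2 : ℝ) ^ (((2 * n : ℕ) : ℝ) / 4) : ℝ) : ℂ)⁻¹ • signedProd l 0 := by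
  simp only [cOrd, signedProd, Pi.zero_apply, Fin.val_zero, pow_zero, one_mul]

theorem cOrd_eq_smul_prod_local (l : Fin (ν + 1)) :
    (cOrd l : Op (SysQ (2 * n) ν)) = (((2 : ℝ) ^ (((2 * n : ℕ) : ℝ) / 4) : ℝ) : ℂ)⁻¹ •
      (List.ofFn fun k : Fin n => localC l k - Complex.I • localD l k).prod := by
  simp only [cOrd_eq_signedProd, signedProd_eq, Pi.zero_apply, Fin.val_zero, pow_zero, one_mul]

theorem residualZ_mem_unitaryGroup (k : Fin n) :
    residualZ ν k ∈ unitaryGroup (Basis (SysQ (2 * n) ν)) ℂ := by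
  rw [residualZ_eq]
  exact pow_mem (zString_mem_unitaryGroup _) _

theorem neg_I_smul_pairD (l : Fin (ν + 1)) (k : Fin n) :
    -Complex.I • pairD l k =
      zString (insert (sndSite k, l) (stringD l k)) * onQubit matX (sndSite k, l) := by
  rw [pairD, smul_neg, neg_smul, neg_neg, ← mul_smul_comm, ← onQubit_smul, I_smul_matY,
    onQubit_mul, ← mul_assoc, zString_insert (snd_notMem_stringD l k),
    (commute_zString_onQubit matZ (snd_notMem_stringD l k)).eq]

theorem matX_mem_unitaryGroup : matX ∈ unitaryGroup (Fin 2) ℂ := by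
  rw [mem_unitaryGroup_iff, star_eq_conjTranspose, matX_conjTranspose, matX_mul_self]

theorem pairC_mem_unitaryGroup (l : Fin (ν + 1)) (k : Fin n) :
    pairC l k ∈ unitaryGroup (Basis (SysQ (2 * n) ν)) ℂ :=
  mul_mem (zString_mem_unitaryGroup _) (onQubit_mem_unitaryGroup matX_mem_unitaryGroup _)

theorem neg_I_smul_pairD_mem_unitaryGroup (l : Fin (ν + 1)) (k : Fin n) :
    -Complex.I • pairD l k ∈ unitaryGroup (Basis (SysQ (2 * n) ν)) ℂ := by
  rw [neg_I_smul_pairD]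
  exact mul_mem (zString_mem_unitaryGroup _) (onQubit_mem_unitaryGroup matX_mem_unitaryGroup _)

theorem localC_mem_unitaryGroup (l : Fin (ν + 1)) (k : Fin n) :
    localC l k ∈ unitaryGroup (Basis (SysQ (2 * n) ν)) ℂ :=
  mul_mem (pairC_mem_unitaryGroup l k) (residualZ_mem_unitaryGroup k)

theorem neg_I_smul_localD_mem_unitaryGroup (l : Fin (ν + 1)) (k : Fin n) :
    -Complex.I • localD l k ∈ unitaryGroup (Basis (SysQ (2 * n) ν)) ℂ := by
  rw [localD_eq, ← smul_mul_assoc]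
  exact mul_mem (neg_I_smul_pairD_mem_unitaryGroup l k) (residualZ_mem_unitaryGroup k)

end Pairs

section Select

variable {Q : Type} [Fintype Q] [DecidableEq Q] {a : Q} {G G' K K' : Op Q}

/-- The operator that applies `G` or `K` according to the value `0` or `1` of the control qubit
`a`; it is meaningful for `G` and `K` that do not act on `a`. -/
noncomputable def select (a : Q) (G K : Op Q) : Op Q := onQubit proj0 a * G + onQubit proj1 a * K

theorem commute_onQubit_of_mem (A : Matrix (Fin 2) (Fin 2) ℂ) (hG : G ∈ localAlgebra {a}ᶜ) :
    Commute (onQubit A a) G :=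
  commute_of_mem_localAlgebra disjoint_compl_right
    (onQubit_mem_localAlgebra A (Finset.mem_singleton_self a)) hG

theorem select_self (a : Q) (G : Op Q) : select a G G = G := by
  rw [select, ← add_mul, ← onQubit_add, proj0_add_proj1, onQubit_one, one_mul]

theorem select_one_neg_one (a : Q) : select a 1 (-1) = onQubit matZ a := by
  rw [select, mul_one, mul_neg_one, ← sub_eq_add_neg, ← onQubit_sub, proj0_sub_proj1]

theorem controlled_eq_select (A : Matrix (Fin 2) (Fin 2) ℂ) (c t : Q) :
    controlled A c t = select c 1 (onQubit A t) := by
  rw [controlled, select, mul_one]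

theorem select_mul_select (hG : G ∈ localAlgebra {a}ᶜ) (hK : K ∈ localAlgebra {a}ᶜ) :
    select a G K * select a G' K' = select a (G * G') (K * K') := by
  have hproj {p p' : Matrix (Fin 2) (Fin 2) ℂ} {B B' : Op Q} (hB : B ∈ localAlgebra {a}ᶜ) :
      onQubit p a * B * (onQubit p' a * B') = onQubit (p * p') a * (B * B') := by
    rw [(commute_onQubit_of_mem p' hB).symm.mul_mul_mul_comm, ← onQubit_mul]
  have hzero : onQubit 0 a = (0 : Op Q) := by rw [← singleQubit_apply, map_zero]
  simp only [select, add_mul, mul_add, hproj hG, hproj hK, proj0_mul_self, proj1_mul_self,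
    proj0_mul_proj1, proj1_mul_proj0, hzero, zero_mul, add_zero, zero_add]

theorem select_conjTranspose (hG : G ∈ localAlgebra {a}ᶜ) (hK : K ∈ localAlgebra {a}ᶜ) :
    (select a G K)ᴴ = select a Gᴴ Kᴴ := by
  simp only [select, conjTranspose_add, (commute_onQubit_of_mem _ hG).eq,
    (commute_onQubit_of_mem _ hK).eq, conjTranspose_mul, onQubit_conjTranspose,
    proj0_conjTranspose, proj1_conjTranspose]

theorem select_mem_unitaryGroup (hG : G ∈ localAlgebra {a}ᶜ) (hK : K ∈ localAlgebra {a}ᶜ)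
    (hGu : G ∈ unitaryGroup (Basis Q) ℂ) (hKu : K ∈ unitaryGroup (Basis Q) ℂ) :
    select a G K ∈ unitaryGroup (Basis Q) ℂ := by
  rw [mem_unitaryGroup_iff, star_eq_conjTranspose] at hGu hKu ⊢
  rw [select_conjTranspose hG hK, select_mul_select hG hK, hGu, hKu, select_self]

theorem select_mem_localAlgebra {T : Finset Q} (ha : a ∈ T) (hG : G ∈ localAlgebra T)
    (hK : K ∈ localAlgebra T) : select a G K ∈ localAlgebra T :=
  add_mem (mul_mem (onQubit_mem_localAlgebra _ ha) hG)
    (mul_mem (onQubit_mem_localAlgebra _ ha) hK)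

theorem onQubit_matX_mul_select_mul (hG : G ∈ localAlgebra {a}ᶜ) (hK : K ∈ localAlgebra {a}ᶜ) :
    onQubit matX a * select a G K * onQubit matX a = select a K G := by
  have hflip {p p' : Matrix (Fin 2) (Fin 2) ℂ} {B : Op Q} (hp : matX * p = p' * matX)
      (hB : B ∈ localAlgebra {a}ᶜ) :
      onQubit matX a * (onQubit p a * B) * onQubit matX a = onQubit p' a * B := by
    rw [mul_assoc, mul_assoc, ← (commute_onQubit_of_mem matX hB).eq, ← mul_assoc, ← mul_assoc,
      ← onQubit_mul, ← onQubit_mul, hp, mul_assoc, matX_mul_self, mul_one]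
  rw [select, mul_add, add_mul, hflip matX_mul_proj0 hG, hflip matX_mul_proj1 hK, add_comm,
    select]

end Select

section System

variable {n ν : ℕ}

theorem sysOp_eq_embed (A : Op (SysQ (2 * n) ν)) :
    (sysOp A : Op (TotQ n ν)) = embed Function.Embedding.inl A := by
  ext x y
  refine if_congr ⟨fun h q hq => ?_, fun h k => h (Sum.inr k) fun _ => Sum.inl_ne_inr⟩ rfl rfl
  rcases q with s | k
  · exact absurd rfl (hq s)
  · exact h k

theorem mem_blockQubits_inl {k : Fin n} {q : SysQ (2 * n) ν} (hq : q ∈ pairQubits ν k) :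
    Sum.inl q ∈ blockQubits ν k :=
  Finset.inl_mem_disjSum.2 hq

theorem mem_blockQubits_inr (k : Fin n) : (Sum.inr k : TotQ n ν) ∈ blockQubits ν k :=
  Finset.inr_mem_disjSum.2 (Finset.mem_singleton_self k)

theorem disjoint_blockQubits {k k' : Fin n} (h : k ≠ k') :
    Disjoint (blockQubits ν k) (blockQubits ν k') := by
  rw [blockQubits, blockQubits, Finset.disjoint_left]
  rintro (q | j)
  · simpa only [Finset.inl_mem_disjSum] using fun h1 h2 =>
      Finset.disjoint_left.1 (disjoint_pairQubits h) h1 h2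
  · simpa only [Finset.inr_mem_disjSum, Finset.mem_singleton] using fun h1 h2 =>
      h (h1.symm.trans h2)

theorem sysOp_mem_localAlgebra_compl (A : Op (SysQ (2 * n) ν)) (k : Fin n) :
    sysOp A ∈ localAlgebra ({Sum.inr k}ᶜ : Finset (TotQ n ν)) := by
  rw [sysOp_eq_embed]
  exact embed_mem_localAlgebra (fun r => by simp) A

theorem sysOp_mem_localAlgebra {A : Op (SysQ (2 * n) ν)} {k : Fin n}
    (hA : A ∈ localAlgebra (pairQubits ν k)) : sysOp A ∈ localAlgebra (blockQubits ν k) := by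
  rw [sysOp_eq_embed]
  exact embed_mem_localAlgebra_of_mem (fun _ => mem_blockQubits_inl) hA

theorem sysOp_mem_unitaryGroup {A : Op (SysQ (2 * n) ν)}
    (hA : A ∈ unitaryGroup (Basis (SysQ (2 * n) ν)) ℂ) :
    sysOp A ∈ unitaryGroup (Basis (TotQ n ν)) ℂ := by
  rw [sysOp_eq_embed]
  exact Unitary.map_mem (embed Function.Embedding.inl) hA

theorem uLocal_eq_select (l : Fin (ν + 1)) (k : Fin n) :
    uLocal l k = select (Sum.inr k) (sysOp (localC l k)) (sysOp (-Complex.I • localD l k)) := rfl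

theorem uLocal_mem_localAlgebra (l : Fin (ν + 1)) (k : Fin n) :
    uLocal l k ∈ localAlgebra (blockQubits ν k) :=
  select_mem_localAlgebra (mem_blockQubits_inr k)
    (sysOp_mem_localAlgebra (localC_mem_localAlgebra l k))
    (sysOp_mem_localAlgebra (SMulMemClass.smul_mem _ (localD_mem_localAlgebra l k)))

theorem uLocal_mem_unitaryGroup (l : Fin (ν + 1)) (k : Fin n) :
    uLocal l k ∈ unitaryGroup (Basis (TotQ n ν)) ℂ :=
  select_mem_unitaryGroup (sysOp_mem_localAlgebra_compl _ k) (sysOp_mem_localAlgebra_compl _ k)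
    (sysOp_mem_unitaryGroup (localC_mem_unitaryGroup l k))
    (sysOp_mem_unitaryGroup (neg_I_smul_localD_mem_unitaryGroup l k))

theorem uOrd_mem_unitaryGroup (l : Fin (ν + 1)) :
    (uOrd l : Op (TotQ n ν)) ∈ unitaryGroup (Basis (TotQ n ν)) ℂ :=
  list_prod_mem <| List.forall_mem_ofFn_iff.2 fun k => uLocal_mem_unitaryGroup l k

theorem matH_mem_unitaryGroup : matH ∈ unitaryGroup (Fin 2) ℂ := by
  rw [mem_unitaryGroup_iff, star_eq_conjTranspose, matH_conjTranspose, matH_mul_self]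

theorem hadAnc_mem_unitaryGroup : hadAnc n ν ∈ unitaryGroup (Basis (TotQ n ν)) ℂ :=
  list_prod_mem <| List.forall_mem_ofFn_iff.2 fun _ =>
    onQubit_mem_unitaryGroup matH_mem_unitaryGroup _

theorem uPrep_mem_unitaryGroup (l : Fin (ν + 1)) :
    (uPrep l : Op (TotQ n ν)) ∈ unitaryGroup (Basis (TotQ n ν)) ℂ :=
  mul_mem (mul_mem hadAnc_mem_unitaryGroup (uOrd_mem_unitaryGroup l)) hadAnc_mem_unitaryGroup

end System

section Measurement

variable {n ν : ℕ}

theorem afterOutcome_add (Φ Ψ : Ket (TotQ n ν)) (m : Fin n → Fin 2) :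
    afterOutcome (Φ + Ψ) m = afterOutcome Φ m + afterOutcome Ψ m := rfl

theorem afterOutcome_sysOp_mulVec (A : Op (SysQ (2 * n) ν)) (Φ : Ket (TotQ n ν))
    (m : Fin n → Fin 2) : afterOutcome (sysOp A *ᵥ Φ) m = A *ᵥ afterOutcome Φ m := by
  ext s
  have hextend (w : Basis (SysQ (2 * n) ν)) :
      Function.extend Function.Embedding.inl w (Sum.elim s m) = Sum.elim w m := by
    ext (q | k)
    · exact congr_arg Fin.val (Sum.inl_injective.extend_apply w _ q)
    · rw [Function.extend_apply' _ _ _ (by simp), Sum.elim_inr, Sum.elim_inr]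
  simp only [afterOutcome, sysOp_eq_embed, embed_mulVec_apply, hextend]
  rfl

theorem afterOutcome_onQubit_mulVec (A : Matrix (Fin 2) (Fin 2) ℂ) (k : Fin n)
    (Φ : Ket (TotQ n ν)) (m : Fin n → Fin 2) :
    afterOutcome (onQubit A (Sum.inr k) *ᵥ Φ) m =
      ∑ b, A (m k) b • afterOutcome Φ (Function.update m k b) := by
  ext s
  simp only [afterOutcome, onQubit_mulVec_apply, Sum.elim_inr, Finset.sum_apply, Pi.smul_apply,
    smul_eq_mul, Sum.update_elim_inr]

theorem afterOutcome_select_mulVec (k : Fin n) (G K : Op (SysQ (2 * n) ν)) (Φ : Ket (TotQ n ν))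
    (m : Fin n → Fin 2) :
    afterOutcome (select (Sum.inr k) (sysOp G) (sysOp K) *ᵥ Φ) m =
      (if m k = 0 then G else K) *ᵥ afterOutcome Φ m := by
  have hm : m k = 0 ∨ m k = 1 := Fin.exists_fin_two.1 ⟨m k, rfl⟩
  have hself : Function.update m k (m k) = m := Function.update_eq_self k m
  rw [select, add_mulVec, afterOutcome_add, ← mulVec_mulVec, ← mulVec_mulVec,
    afterOutcome_onQubit_mulVec, afterOutcome_onQubit_mulVec]
  rcases hm with hm | hm <;> rw [hm] at hself <;>
    simp [hm, proj0, proj1, afterOutcome_sysOp_mulVec, hself]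

theorem matH_apply_zero (b : Fin 2) : matH b 0 = ((Real.sqrt 2 : ℝ) : ℂ)⁻¹ := by
  fin_cases b <;> simp [matH]

theorem matH_apply_one (b : Fin 2) :
    matH b 1 = ((Real.sqrt 2 : ℝ) : ℂ)⁻¹ * (-1) ^ (b : ℕ) := by
  fin_cases b <;> simp [matH]

/-- Linear combination of unitaries with one ancilla: between two Hadamard gates on an ancilla in
the state `|0⟩`, the controlled choice between `G` and `K` becomes, up to normalization, `G + K` or
`G - K` according to the measured value of the ancilla. -/
theorem afterOutcome_matH_mul_select_mul_matH_mulVec {k : Fin n} (G K : Op (SysQ (2 * n) ν))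
    {Φ : Ket (TotQ n ν)} (hΦ : ∀ m, m k ≠ 0 → afterOutcome Φ m = 0) (m : Fin n → Fin 2) :
    afterOutcome ((onQubit matH (Sum.inr k) * select (Sum.inr k) (sysOp G) (sysOp K) *
      onQubit matH (Sum.inr k)) *ᵥ Φ) m =
      ((2 : ℂ)⁻¹ • (G + (-1 : ℂ) ^ (m k : ℕ) • K)) *ᵥ
        afterOutcome Φ (Function.update m k 0) := by
  have hplus (b : Fin 2) : afterOutcome (onQubit matH (Sum.inr k) *ᵥ Φ) (Function.update m k b) =
      ((Real.sqrt 2 : ℝ) : ℂ)⁻¹ • afterOutcome Φ (Function.update m k 0) := by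
    rw [afterOutcome_onQubit_mulVec, Fin.sum_univ_two, Function.update_idem, Function.update_idem,
      hΦ (Function.update m k 1) (by simp), smul_zero, add_zero, matH_apply_zero]
  rw [← mulVec_mulVec, ← mulVec_mulVec, afterOutcome_onQubit_mulVec, Fin.sum_univ_two,
    afterOutcome_select_mulVec, afterOutcome_select_mulVec, hplus, hplus, Function.update_self,
    Function.update_self, if_pos rfl, if_neg one_ne_zero, matH_apply_zero, matH_apply_one,
    mulVec_smul, mulVec_smul, smul_smul, smul_smul, mul_right_comm, inv_sqrt_two_mul_self,
    mul_smul, ← smul_add, smul_mulVec, add_mulVec, smul_mulVec]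

theorem afterOutcome_prod_mulVec (G K : Fin n → Op (SysQ (2 * n) ν)) {L : List (Fin n)}
    (hL : L.Nodup) {Φ : Ket (TotQ n ν)} (hΦ : ∀ k ∈ L, ∀ m, m k ≠ 0 → afterOutcome Φ m = 0)
    (m : Fin n → Fin 2) :
    afterOutcome ((L.map fun k => onQubit matH (Sum.inr k) *
      select (Sum.inr k) (sysOp (G k)) (sysOp (K k)) * onQubit matH (Sum.inr k)).prod *ᵥ Φ) m =
      (L.map fun k => (2 : ℂ)⁻¹ • (G k + (-1 : ℂ) ^ (m k : ℕ) • K k)).prod *ᵥ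
        afterOutcome Φ (fun k => if k ∈ L then 0 else m k) := by
  induction L generalizing m with
  | nil => simp
  | cons k L ih =>
    obtain ⟨hkL, hL⟩ := List.nodup_cons.1 hL
    have ih := ih hL fun j hj => hΦ j (List.mem_cons_of_mem k hj)
    rw [List.map_cons, List.prod_cons, ← mulVec_mulVec,
      afterOutcome_matH_mul_select_mul_matH_mulVec _ _ fun m' hm' => ?_, ih, List.map_cons,
      List.prod_cons, ← mulVec_mulVec]
    · have hmap : L.map (fun j => (2 : ℂ)⁻¹ •
          (G j + (-1 : ℂ) ^ (Function.update m k 0 j : ℕ) • K j)) =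
          L.map fun j => (2 : ℂ)⁻¹ • (G j + (-1 : ℂ) ^ (m j : ℕ) • K j) :=
        List.map_congr_left fun j hj => by
          rw [Function.update_of_ne (ne_of_mem_of_not_mem hj hkL)]
      have hzeros : (fun j => if j ∈ L then 0 else Function.update m k 0 j) =
          fun j => if j ∈ k :: L then 0 else m j := by
        ext j
        by_cases hjk : j = k <;> simp [hjk, hkL]
      rw [hmap, hzeros]
    · rw [ih, hΦ k List.mem_cons_self _ (by rwa [if_neg hkL]), mulVec_zero]

theorem afterOutcome_withZeroAnc (ψ : Ket (SysQ (2 * n) ν)) (m : Fin n → Fin 2) :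
    afterOutcome (withZeroAnc ψ) m = if m = 0 then ψ else 0 := by
  ext s
  rw [ite_apply]
  exact if_congr funext_iff.symm rfl rfl

theorem uPrep_eq_prod (l : Fin (ν + 1)) :
    (uPrep l : Op (TotQ n ν)) = (List.ofFn fun k : Fin n =>
      onQubit matH (Sum.inr k) * uLocal l k * onQubit matH (Sum.inr k)).prod := by
  have hcomm {i j : Fin n} (hij : i ≠ j) {A B : Op (TotQ n ν)}
      (hA : A ∈ localAlgebra (blockQubits ν i)) (hB : B ∈ localAlgebra (blockQubits ν j)) :
      Commute A B :=
    commute_of_mem_localAlgebra (disjoint_blockQubits hij) hA hB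
  have hH (k : Fin n) : onQubit matH (Sum.inr k) ∈ localAlgebra (blockQubits ν k) :=
    onQubit_mem_localAlgebra _ (mem_blockQubits_inr k)
  have hU (k : Fin n) : uLocal l k ∈ localAlgebra (blockQubits ν k) := uLocal_mem_localAlgebra l k
  rw [uPrep, uOrd, hadAnc, prod_ofFn_mul_prod_ofFn fun i j hij => hcomm hij (hH i) (hU j),
    prod_ofFn_mul_prod_ofFn fun i j hij => hcomm hij (mul_mem (hH i) (hU i)) (hH j)]

theorem afterOutcome_uPrep (l : Fin (ν + 1)) (ψ : Ket (SysQ (2 * n) ν)) (m : Fin n → Fin 2) :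
    afterOutcome (uPrep l *ᵥ withZeroAnc ψ) m = ((2 : ℂ) ^ n)⁻¹ • (signedProd l m *ᵥ ψ) := by
  have hfactor (k : Fin n) : localC l k + (-1 : ℂ) ^ (m k : ℕ) • (-Complex.I • localD l k) =
      localC l k - ((-1 : ℂ) ^ (m k : ℕ) * Complex.I) • localD l k := by
    rw [smul_smul, mul_neg, neg_smul, sub_eq_add_neg]
  have hzero (k : Fin n) (m : Fin n → Fin 2) (hm : m k ≠ 0) :
      afterOutcome (withZeroAnc ψ) m = 0 := by
    rw [afterOutcome_withZeroAnc, if_neg fun h => hm (congr_fun h k)]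
  have hψ : afterOutcome (withZeroAnc ψ) (fun k => if k ∈ List.finRange n then 0 else m k) = ψ := by
    simp only [List.mem_finRange, if_true, afterOutcome_withZeroAnc]
    exact if_pos rfl
  have hscalar (B : Fin n → Op (SysQ (2 * n) ν)) :
      ((List.finRange n).map fun k => (2 : ℂ)⁻¹ • B k).prod =
        ((2 : ℂ) ^ n)⁻¹ • ((List.finRange n).map B).prod := by
    have h := List.smul_prod ((List.finRange n).map B) (2 : ℂ)⁻¹
    rw [List.length_map, List.length_finRange, List.map_map, inv_pow] at h
    exact h.symm
  simp only [uPrep_eq_prod, List.ofFn_eq_map, uLocal_eq_select]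
  rw [afterOutcome_prod_mulVec _ _ (List.nodup_finRange n) fun k _ => hzero k, hψ, hscalar,
    signedProd_eq, List.ofFn_eq_map, smul_mulVec]
  simp only [hfactor]

theorem two_rpow_inv_mul_self (n : ℕ) :
    (((2 : ℝ) ^ (((2 * n : ℕ) : ℝ) / 4) : ℝ) : ℂ)⁻¹ *
      (((2 : ℝ) ^ (((2 * n : ℕ) : ℝ) / 4) : ℝ) : ℂ)⁻¹ = ((2 : ℂ) ^ n)⁻¹ := by
  have hexp : ((2 * n : ℕ) : ℝ) / 4 + ((2 * n : ℕ) : ℝ) / 4 = n := by push_cast; ring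
  rw [← mul_inv, ← Complex.ofReal_mul, ← Real.rpow_add two_pos, hexp, Real.rpow_natCast,
    Complex.ofReal_pow, Complex.ofReal_ofNat]

end Measurement

section Circuits

variable {Q : Type} [Fintype Q] [DecidableEq Q]

theorem Gate.op_mem_localAlgebra (g : Gate Q) : g.op ∈ localAlgebra g.qubits := by
  have hctrl (A : Matrix (Fin 2) (Fin 2) ℂ) (c t : Q) :
      controlled A c t ∈ localAlgebra {c, t} := by
    rw [controlled_eq_select]
    exact select_mem_localAlgebra (Finset.mem_insert_self c _) (one_mem _)
      (onQubit_mem_localAlgebra A (Finset.mem_insert_of_mem (Finset.mem_singleton_self t)))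
  cases g with
  | had q => exact onQubit_mem_localAlgebra matH (Finset.mem_singleton_self q)
  | x q => exact onQubit_mem_localAlgebra matX (Finset.mem_singleton_self q)
  | cx c t _ => exact hctrl matX c t
  | cz c t _ => exact hctrl matZ c t

theorem Layer.op_mem_localAlgebra {L : Layer Q} {T : Finset Q}
    (hL : ∀ g ∈ L.gates, g.qubits ⊆ T) : L.op ∈ localAlgebra T :=
  list_prod_mem <| List.forall_mem_map.2 fun g hg =>
    localAlgebra_mono (hL g hg) g.op_mem_localAlgebra

/-- `HasCircuit T D A`: the operator `A` is implemented by a circuit of depth exactly `D` all of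
whose gates touch only qubits of `T`. Layers may be empty, so larger depths are possible as well. -/
inductive HasCircuit (T : Finset Q) : ℕ → Op Q → Prop
  | nil : HasCircuit T 0 1
  | cons {D : ℕ} {A : Op Q} (L : Layer Q) (hL : ∀ g ∈ L.gates, g.qubits ⊆ T)
      (hA : HasCircuit T D A) : HasCircuit T (D + 1) (A * L.op)

namespace HasCircuit

variable {S T : Finset Q} {D D' : ℕ} {A B : Op Q}

theorem exists_circuit (h : HasCircuit T D A) : ∃ C : Circuit Q, C.op = A ∧ C.depth = D := by
  induction h with
  | nil => exact ⟨[], rfl, rfl⟩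
  | cons L _ _ ih =>
    obtain ⟨C, rfl, rfl⟩ := ih
    exact ⟨L :: C, by simp [Circuit.op], rfl⟩

theorem mem_localAlgebra (h : HasCircuit T D A) : A ∈ localAlgebra T := by
  induction h with
  | nil => exact one_mem _
  | cons L hL _ ih => exact mul_mem ih (Layer.op_mem_localAlgebra hL)

theorem mono_qubits (h : HasCircuit S D A) (hST : S ⊆ T) : HasCircuit T D A := by
  induction h with
  | nil => exact .nil
  | cons L hL _ ih => exact .cons L (fun g hg => (hL g hg).trans hST) ih

theorem one (T : Finset Q) : ∀ D, HasCircuit T D 1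
  | 0 => .nil
  | D + 1 => by
    simpa [Layer.op] using cons (⟨[], .nil⟩ : Layer Q) (fun _ h => by simp at h) (one T D)

theorem mul (hA : HasCircuit T D A) (hB : HasCircuit T D' B) :
    HasCircuit T (D + D') (A * B) := by
  induction hB with
  | nil => rwa [mul_one]
  | cons L hL _ ih => simpa only [mul_assoc, ← add_assoc] using ih.cons L hL

theorem mono_depth (h : HasCircuit T D A) (hD : D ≤ D') : HasCircuit T D' A := by
  obtain ⟨e, rfl⟩ := Nat.exists_eq_add_of_le hD
  simpa only [mul_one] using h.mul (one T e)

theorem gate (g : Gate Q) (hg : g.qubits ⊆ T) : HasCircuit T 1 g.op := by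
  simpa [Layer.op] using nil.cons (T := T) ⟨[g], List.pairwise_singleton _ g⟩ (by simpa using hg)

theorem par (hST : Disjoint S T) (hA : HasCircuit S D A) (hB : HasCircuit T D B) :
    HasCircuit (S ∪ T) D (A * B) := by
  induction hA generalizing B with
  | nil =>
    rw [one_mul]
    exact hB.mono_qubits Finset.subset_union_right
  | cons L hL _ ih =>
    obtain _ | ⟨L', hL', hB⟩ := hB
    have hLL' : (L.gates ++ L'.gates).Pairwise fun g g' => Disjoint g.qubits g'.qubits :=
      List.pairwise_append.2 ⟨L.disjoint, L'.disjoint, fun g hg g' hg' =>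
        hST.mono (hL g hg) (hL' g' hg')⟩
    have hcomm : Commute L.op _ :=
      commute_of_mem_localAlgebra hST (Layer.op_mem_localAlgebra hL) hB.mem_localAlgebra
    rw [hcomm.mul_mul_mul_comm]
    have hop : L.op * L'.op = Layer.op ⟨L.gates ++ L'.gates, hLL'⟩ := by simp [Layer.op]
    rw [hop]
    exact (ih hB).cons _ fun g hg => (List.mem_append.1 hg).elim
      (fun h => (hL g h).trans Finset.subset_union_left)
      fun h => (hL' g h).trans Finset.subset_union_right

theorem prod_map {ι : Type*} [DecidableEq ι] {T : ι → Finset Q} {A : ι → Op Q}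
    (hT : Pairwise fun i j => Disjoint (T i) (T j)) (hA : ∀ i, HasCircuit (T i) D (A i))
    {L : List ι} (hL : L.Nodup) :
    HasCircuit (L.toFinset.biUnion T) D (L.map A).prod := by
  induction L with
  | nil => exact one _ D
  | cons i L ih =>
    obtain ⟨hi, hL⟩ := List.nodup_cons.1 hL
    rw [List.toFinset_cons, Finset.biUnion_insert, List.map_cons, List.prod_cons]
    refine par ((Finset.disjoint_biUnion_right _ _ _).2 fun j hj => hT ?_) (hA i) (ih hL)
    rintro rfl
    exact hi (List.mem_toFinset.1 hj)

theorem prod_ofFn {n : ℕ} {T : Fin n → Finset Q} {A : Fin n → Op Q}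
    (hT : Pairwise fun i j => Disjoint (T i) (T j)) (hA : ∀ i, HasCircuit (T i) D (A i)) :
    HasCircuit Finset.univ D (List.ofFn A).prod := by
  rw [List.ofFn_eq_map]
  exact (prod_map hT hA (List.nodup_finRange n)).mono_qubits (Finset.subset_univ _)

theorem onQubit_matX {q : Q} (hq : q ∈ T) : HasCircuit T 1 (onQubit matX q) :=
  gate (.x q) (Finset.singleton_subset_iff.2 hq)

theorem onQubit_matH {q : Q} (hq : q ∈ T) : HasCircuit T 1 (onQubit matH q) :=
  gate (.had q) (Finset.singleton_subset_iff.2 hq)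

theorem select_one_onQubit_matX {c t : Q} (h : c ≠ t) (hc : c ∈ T) (ht : t ∈ T) :
    HasCircuit T 1 (select c 1 (onQubit matX t)) := by
  rw [← controlled_eq_select]
  exact gate (.cx c t h) (Finset.insert_subset hc (Finset.singleton_subset_iff.2 ht))

theorem select_one_onQubit_matZ {c t : Q} (h : c ≠ t) (hc : c ∈ T) (ht : t ∈ T) :
    HasCircuit T 1 (select c 1 (onQubit matZ t)) := by
  rw [← controlled_eq_select]
  exact gate (.cz c t h) (Finset.insert_subset hc (Finset.singleton_subset_iff.2 ht))

theorem zString (T : Finset Q) : HasCircuit T 3 (zString T) := by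
  induction T using Finset.induction_on with
  | empty =>
    rw [zString_empty]
    exact one _ 3
  | insert q T hq ih =>
    have hqq : q ∈ ({q} : Finset Q) := Finset.mem_singleton_self q
    rw [zString_insert hq, Finset.insert_eq, ← matH_mul_matX_mul_matH, onQubit_mul, onQubit_mul]
    exact par (Finset.disjoint_singleton_left.2 hq)
      (((onQubit_matH hqq).mul (onQubit_matX hqq)).mul (onQubit_matH hqq)) ih

end HasCircuit

theorem onQubit_mem_localAlgebra_compl (A : Matrix (Fin 2) (Fin 2) ℂ) {a q : Q} (h : a ≠ q) :
    onQubit A q ∈ localAlgebra {a}ᶜ :=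
  onQubit_mem_localAlgebra A (Finset.mem_compl.2 fun hq => h (Finset.mem_singleton.1 hq).symm)

theorem select_one_matX_mul_self {c t : Q} (h : c ≠ t) :
    select c 1 (onQubit matX t) * select c 1 (onQubit matX t) = 1 := by
  rw [select_mul_select (one_mem _) (onQubit_mem_localAlgebra_compl matX h), ← onQubit_mul,
    matX_mul_self, onQubit_one, mul_one, select_self]

theorem select_one_matX_conj_matZ {c t : Q} (h : c ≠ t) :
    select c 1 (onQubit matX t) * onQubit matZ t * select c 1 (onQubit matX t) =
      onQubit matZ t * onQubit matZ c := by
  have hX : onQubit matX t ∈ localAlgebra {c}ᶜ := onQubit_mem_localAlgebra_compl matX h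
  have hZ : onQubit matZ t ∈ localAlgebra {c}ᶜ := onQubit_mem_localAlgebra_compl matZ h
  have hXZX : onQubit matX t * onQubit matZ t * onQubit matX t = -onQubit matZ t := by
    rw [← onQubit_mul, ← onQubit_mul, mul_assoc, matZ_mul_matX, mul_neg, ← mul_assoc,
      matX_mul_self, one_mul, onQubit_neg]
  rw [← select_one_neg_one c, ← select_self c (onQubit matZ t),
    select_mul_select (one_mem _) hX, select_mul_select (mul_mem (one_mem _) hZ) (mul_mem hX hZ),
    select_mul_select hZ hZ, hXZX, one_mul, mul_neg_one, mul_one]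

theorem mul_select_one_mul {a : Q} {E E' : Op Q} (G : Op Q) (hE : E' ∈ localAlgebra {a}ᶜ)
    (hG : G ∈ localAlgebra {a}ᶜ) (h : E' * E = 1) :
    E' * select a 1 G * E = select a 1 (E' * G * E) := by
  conv_lhs => rw [← select_self a E', ← select_self a E]
  rw [select_mul_select hE hE, select_mul_select (mul_mem hE (one_mem _)) (mul_mem hE hG),
    mul_one, h]

theorem mul_mul_mul_mul_of_commute {M : Type*} [Monoid M] {a a' b b' u v : M}
    (hbu : Commute b' u) (hba : Commute b' a) (hva : Commute v a) :
    a' * b' * (u * v) * (a * b) = a' * u * a * (b' * v * b) := by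
  rw [hbu.mul_mul_mul_comm, (hba.mul_left hva).mul_mul_mul_comm]

/-- The parity of the qubits in `T` can be collected in the qubit `t`: some depth `d` circuit `E`
on `T`, with an inverse `E'` of the same kind, conjugates `Z_t` to the product of all `Z_q`,
`q ∈ T`. -/
def CollectsParity (d : ℕ) (T : Finset Q) (t : Q) : Prop :=
  ∃ E E' : Op Q, HasCircuit T d E ∧ HasCircuit T d E' ∧ E' * E = 1 ∧
    E' * onQubit matZ t * E = zString T

namespace CollectsParity

variable {d : ℕ} {S T : Finset Q} {s t : Q}

theorem mono {d' : ℕ} (h : CollectsParity d T t) (hd : d ≤ d') : CollectsParity d' T t := by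
  obtain ⟨E, E', hE, hE', hinv, hconj⟩ := h
  exact ⟨E, E', hE.mono_depth hd, hE'.mono_depth hd, hinv, hconj⟩

theorem singleton (t : Q) : CollectsParity 0 {t} t :=
  ⟨1, 1, .nil, .nil, one_mul 1, by rw [one_mul, mul_one, zString_singleton]⟩

theorem union (hST : Disjoint S T) (hs : s ∈ S) (ht : t ∈ T) (hS : CollectsParity d S s)
    (hT : CollectsParity d T t) : CollectsParity (d + 1) (S ∪ T) s := by
  obtain ⟨E, E', hE, hE', hinvE, hconjE⟩ := hS
  obtain ⟨F, F', hF, hF', hinvF, hconjF⟩ := hT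
  have hts : t ≠ s := fun h => Finset.disjoint_left.1 hST hs (h ▸ ht)
  set X := select t 1 (onQubit matX s)
  have hXX : X * X = 1 := select_one_matX_mul_self hts
  have hXZX : X * onQubit matZ s * X = onQubit matZ s * onQubit matZ t :=
    select_one_matX_conj_matZ hts
  have hXc : HasCircuit (S ∪ T) 1 X :=
    .select_one_onQubit_matX hts (Finset.mem_union_right S ht) (Finset.mem_union_left T hs)
  have hFE : Commute F' E :=
    (commute_of_mem_localAlgebra hST hE.mem_localAlgebra hF'.mem_localAlgebra).symm
  have hFZ : Commute F' (onQubit matZ s) :=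
    (commute_of_mem_localAlgebra hST (onQubit_mem_localAlgebra matZ hs) hF'.mem_localAlgebra).symm
  have hZE : Commute (onQubit matZ t) E :=
    (commute_of_mem_localAlgebra hST hE.mem_localAlgebra (onQubit_mem_localAlgebra matZ ht)).symm
  refine ⟨X * (E * F), E' * F' * X, add_comm 1 d ▸ hXc.mul (hE.par hST hF),
    (hE'.par hST hF').mul hXc, ?_, ?_⟩
  · calc E' * F' * X * (X * (E * F)) = E' * F' * (X * X) * (E * F) := by simp only [mul_assoc]
      _ = E' * E * (F' * F) := by rw [hXX, mul_one, hFE.mul_mul_mul_comm]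
      _ = 1 := by rw [hinvE, hinvF, one_mul]
  · calc E' * F' * X * onQubit matZ s * (X * (E * F))
        = E' * F' * (X * onQubit matZ s * X) * (E * F) := by simp only [mul_assoc]
      _ = E' * onQubit matZ s * E * (F' * onQubit matZ t * F) := by
        rw [hXZX, mul_mul_mul_mul_of_commute hFZ hFE hZE]
      _ = zString (S ∪ T) := by rw [hconjE, hconjF, zString_union hST]

theorem of_card_le (ht : t ∈ T) (hT : T.card ≤ 2 ^ d) : CollectsParity d T t := by
  induction d generalizing T t with
  | zero =>
    obtain rfl : T = {t} := Finset.eq_singleton_iff_unique_mem.2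
      ⟨ht, fun s hs => Finset.card_le_one.1 hT s hs t ht⟩
    exact singleton t
  | succ d ih =>
    obtain hd | hd := le_or_gt T.card (2 ^ d)
    · exact (ih ht hd).mono d.le_succ
    obtain ⟨S, htS, hST, hS⟩ := Finset.exists_subsuperset_card_eq
      (Finset.singleton_subset_iff.2 ht) Nat.one_le_two_pow hd.le
    have hcard : (T \ S).card = T.card - 2 ^ d := by rw [Finset.card_sdiff_of_subset hST, hS]
    obtain ⟨r, hr⟩ : (T \ S).Nonempty := Finset.card_pos.1 (by omega)
    rw [Finset.singleton_subset_iff] at htS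
    rw [← Finset.union_sdiff_of_subset hST]
    exact union Finset.disjoint_sdiff htS hr (ih htS hS.le) (ih hr (by rw [pow_succ] at hT; omega))

end CollectsParity

namespace HasCircuit

theorem select_one_zString {d : ℕ} {T : Finset Q} {a : Q} (ha : a ∉ T) (hT : T.card ≤ 2 ^ d) :
    HasCircuit (insert a T) (2 * d + 1) (select a 1 (OrderedPrep.zString T)) := by
  obtain rfl | ⟨t, ht⟩ := T.eq_empty_or_nonempty
  · rw [zString_empty, select_self]
    exact one _ _
  obtain ⟨E, E', hE, hE', hinv, hconj⟩ := CollectsParity.of_card_le ht hT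
  have hsub : T ⊆ insert a T := Finset.subset_insert a T
  have hat : a ≠ t := fun h => ha (h ▸ ht)
  have hE'a : E' ∈ localAlgebra {a}ᶜ :=
    localAlgebra_mono (fun q hq => by simpa using ne_of_mem_of_not_mem hq ha) hE'.mem_localAlgebra
  rw [← hconj, ← mul_select_one_mul _ hE'a (onQubit_mem_localAlgebra_compl matZ hat) hinv]
  have hCZ : HasCircuit (insert a T) 1 (select a 1 (onQubit matZ t)) :=
    select_one_onQubit_matZ hat (Finset.mem_insert_self a T) (hsub ht)
  exact (((hE'.mono_qubits hsub).mul hCZ).mul (hE.mono_qubits hsub)).mono_depth (by omega)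

theorem select_one_zString_mul_onQubit_matX {d : ℕ} {S T : Finset Q} {a q : Q} (ha : a ∉ S)
    (haq : a ≠ q) (hS : S.card ≤ 2 ^ d) (haT : a ∈ T) (hqT : q ∈ T) (hST : S ⊆ T) :
    HasCircuit T (2 * d + 2) (select a 1 (OrderedPrep.zString S * onQubit matX q)) := by
  have hSa : OrderedPrep.zString S ∈ localAlgebra {a}ᶜ :=
    zString_mem_localAlgebra fun r hr => by simpa using ne_of_mem_of_not_mem hr ha
  rw [← one_mul (1 : Op Q), ← select_mul_select (one_mem _) hSa]
  exact ((select_one_zString ha hS).mono_qubits (Finset.insert_subset haT hST)).mul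
    (select_one_onQubit_matX haq haT hqT)

end HasCircuit

end Circuits

section Depth

variable {n ν : ℕ}

theorem uLocal_eq_mul (l : Fin (ν + 1)) (k : Fin n) :
    uLocal l k = onQubit matX (Sum.inr k) * select (Sum.inr k) 1 (sysOp (pairC l k)) *
      onQubit matX (Sum.inr k) * select (Sum.inr k) 1 (sysOp (-Complex.I • pairD l k)) *
        sysOp (residualZ ν k) := by
  have hC := sysOp_mem_localAlgebra_compl (pairC l k) k
  have hD := sysOp_mem_localAlgebra_compl (-Complex.I • pairD l k) k
  rw [onQubit_matX_mul_select_mul (one_mem _) hC, select_mul_select hC (one_mem _), mul_one,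
    one_mul, ← select_self (Sum.inr k) (sysOp (residualZ ν k)), select_mul_select hC hD,
    uLocal_eq_select, localC_eq, localD_eq, ← smul_mul_assoc]
  simp only [sysOp_eq_embed, map_mul]

theorem map_inl_subset_blockQubits {k : Fin n} {S : Finset (SysQ (2 * n) ν)}
    (hS : S ⊆ pairQubits ν k) : S.map Function.Embedding.inl ⊆ blockQubits ν k := by
  intro r hr
  obtain ⟨q, hq, rfl⟩ := Finset.mem_map.1 hr
  exact mem_blockQubits_inl (hS hq)

namespace HasCircuit

theorem select_one_sysOp {d : ℕ} {k : Fin n} {S : Finset (SysQ (2 * n) ν)} {q : SysQ (2 * n) ν}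
    (hS : S ⊆ pairQubits ν k) (hq : q ∈ pairQubits ν k) (hd : 2 * (ν + 1) ≤ 2 ^ d) :
    HasCircuit (blockQubits ν k) (2 * d + 2)
      (select (Sum.inr k) 1 (sysOp (OrderedPrep.zString S * onQubit matX q))) := by
  have hcard : S.card ≤ 2 ^ d :=
    ((Finset.card_le_card hS).trans (card_pairQubits k).le).trans hd
  rw [sysOp_eq_embed, map_mul, embed_zString, embed_onQubit]
  exact select_one_zString_mul_onQubit_matX (by simp) Sum.inr_ne_inl
    ((Finset.card_map _).le.trans hcard) (mem_blockQubits_inr k) (mem_blockQubits_inl hq)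
    (map_inl_subset_blockQubits hS)

theorem sysOp_residualZ (k : Fin n) :
    HasCircuit (blockQubits ν k) 3 (sysOp (residualZ ν k)) := by
  rw [residualZ_eq, sysOp_eq_embed, map_pow, embed_zString]
  obtain ⟨r, h | h⟩ := Nat.even_or_odd' (n - ((k : ℕ) + 1))
  · rw [h, pow_mul, pow_two, zString_mul_self, one_pow]
    exact one _ 3
  · rw [h, pow_succ, pow_mul, pow_two, zString_mul_self, one_pow, one_mul]
    exact (zString _).mono_qubits (map_inl_subset_blockQubits subset_rfl)

theorem uLocal (l : Fin (ν + 1)) (k : Fin n) {d : ℕ} (hd : 2 * (ν + 1) ≤ 2 ^ d) :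
    HasCircuit (blockQubits ν k) (4 * d + 9) (uLocal l k) := by
  have hX : HasCircuit (blockQubits ν k) 1 (onQubit matX (Sum.inr k)) :=
    onQubit_matX (mem_blockQubits_inr k)
  have hfst : (fstSite k, l) ∈ pairQubits ν k := mem_pairQubits.2 (Or.inl rfl)
  have hsnd : (sndSite k, l) ∈ pairQubits ν k := mem_pairQubits.2 (Or.inr rfl)
  have hC := select_one_sysOp (stringC_subset l k) hfst hd
  have hD := select_one_sysOp (Finset.insert_subset hsnd (stringD_subset l k)) hsnd hd
  rw [uLocal_eq_mul, neg_I_smul_pairD]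
  exact ((((hX.mul hC).mul hX).mul hD).mul (sysOp_residualZ k)).mono_depth (by omega)

theorem uOrd (l : Fin (ν + 1)) {d : ℕ} (hd : 2 * (ν + 1) ≤ 2 ^ d) :
    HasCircuit Finset.univ (4 * d + 9) (uOrd l : Op (TotQ n ν)) :=
  prod_ofFn (fun _ _ => disjoint_blockQubits) fun k => uLocal l k hd

theorem hadAnc : HasCircuit Finset.univ 1 (hadAnc n ν) :=
  prod_ofFn (T := fun k => {Sum.inr k}) (fun _ _ hij => by simpa using hij) fun _ =>
    onQubit_matH (Finset.mem_singleton_self _)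

theorem uPrep (l : Fin (ν + 1)) {d : ℕ} (hd : 2 * (ν + 1) ≤ 2 ^ d) :
    HasCircuit Finset.univ (4 * d + 11) (uPrep l : Op (TotQ n ν)) :=
  ((hadAnc.mul (uOrd l hd)).mul hadAnc).mono_depth (by omega)

end HasCircuit

theorem two_mul_succ_le_two_pow (ν : ℕ) : 2 * (ν + 1) ≤ 2 ^ (Nat.log 2 ν + 2) := by
  have hlog : ν < 2 ^ (Nat.log 2 ν + 1) := Nat.lt_pow_succ_log_self one_lt_two ν
  rw [pow_succ]
  omega

theorem natLog_two_le_two_mul_log (ν : ℕ) : (Nat.log 2 ν : ℝ) ≤ 2 * Real.log ν := by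
  calc (Nat.log 2 ν : ℝ) ≤ Real.log ν / Real.log 2 := by
        simpa only [Real.logb, Nat.cast_ofNat] using Real.natLog_le_logb ν 2
    _ ≤ 2 * Real.log ν := by
        rw [div_le_iff₀ (Real.log_pos one_lt_two)]
        nlinarith [Real.log_two_gt_d9, Real.log_natCast_nonneg ν]

theorem exists_circuit_depth_le {D ν : ℕ} {Q : Type} [Fintype Q] [DecidableEq Q] {T : Finset Q}
    {A : Op Q} (h : HasCircuit T D A) (hD : D ≤ 4 * (Nat.log 2 ν + 2) + 11) :
    ∃ C : Circuit Q, C.op = A ∧ (C.depth : ℝ) ≤ 19 * (1 + Real.log ν) := by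
  obtain ⟨C, hC, rfl⟩ := h.exists_circuit
  refine ⟨C, hC, ?_⟩
  calc (C.depth : ℝ) ≤ 4 * (Nat.log 2 ν + 2) + 11 := by exact_mod_cast hD
    _ ≤ 19 * (1 + Real.log ν) := by
        linarith [natLog_two_le_two_mul_log ν, Real.log_natCast_nonneg ν]

end Depth

end OrderedPrep

theorem mainTheorem6 :
    (∀ (n ν : ℕ) (l : Fin (ν + 1)), l ≠ 0 →
      -- product of local operators on disjoint sets of qubits
      (cOrd l : Op (SysQ (2 * n) ν)) =
        (((2 : ℝ) ^ (((2 * n : ℕ) : ℝ) / 4) : ℝ) : ℂ)⁻¹ •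
          (List.ofFn fun k : Fin n => localC l k - Complex.I • localD l k).prod ∧
      (∀ k : Fin n,
        SupportedOn (localC l k) (pairQubits ν k) ∧ SupportedOn (localD l k) (pairQubits ν k) ∧
        weight (localC l k) ≤ 2 * (ν + 1) ∧ weight (localD l k) ≤ 2 * (ν + 1)) ∧
      (∀ k k' : Fin n, k ≠ k' → Disjoint (pairQubits ν k) (pairQubits ν k')) ∧
      -- the unitary on the system and `N / 2 = n` ancillas
      (∀ k : Fin n,
        uLocal l k ∈ Matrix.unitaryGroup (Basis (TotQ n ν)) ℂ ∧
        SupportedOn (uLocal l k) (blockQubits ν k)) ∧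
      (∀ k k' : Fin n, k ≠ k' → Disjoint (blockQubits ν k) (blockQubits ν k')) ∧
      (uOrd l : Op (TotQ n ν)) ∈ Matrix.unitaryGroup (Basis (TotQ n ν)) ℂ ∧
      (uPrep l : Op (TotQ n ν)) ∈ Matrix.unitaryGroup (Basis (TotQ n ν)) ℂ ∧
      -- measurement of the ancillas, and the sign correction of the stabilizers
      (∀ (ψ : Ket (SysQ (2 * n) ν)) (m : Fin n → Fin 2),
        afterOutcome (uPrep l *ᵥ withZeroAnc ψ) m = ((2 : ℂ) ^ n)⁻¹ • (signedProd l m *ᵥ ψ) ∧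
        ∀ k : Fin n,
          ((-1 : ℂ) ^ (m k : ℕ) • stab l (fstSite k) (sndSite k)) *ᵥ
              afterOutcome (uPrep l *ᵥ withZeroAnc ψ) m =
            afterOutcome (uPrep l *ᵥ withZeroAnc ψ) m) ∧
      (∀ ψ : Ket (SysQ (2 * n) ν),
        afterOutcome (uPrep l *ᵥ withZeroAnc ψ) 0 =
          (((2 : ℝ) ^ (((2 * n : ℕ) : ℝ) / 4) : ℝ) : ℂ)⁻¹ • (cOrd l *ᵥ ψ))) ∧
    -- circuit depth `O(log ν)`, uniformly in the number of sites and in the auxiliary index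
    (∃ K : ℝ, ∀ (n ν : ℕ) (l : Fin (ν + 1)), l ≠ 0 →
      (∃ C : Circuit (TotQ n ν), C.op = uOrd l ∧ (C.depth : ℝ) ≤ K * (1 + Real.log ν)) ∧
      (∃ C : Circuit (TotQ n ν), C.op = uPrep l ∧ (C.depth : ℝ) ≤ K * (1 + Real.log ν))) := by
  refine ⟨fun n ν l _ => ⟨cOrd_eq_smul_prod_local l,
    fun k => ⟨mem_localAlgebra_iff_supportedOn.1 (localC_mem_localAlgebra l k),
      mem_localAlgebra_iff_supportedOn.1 (localD_mem_localAlgebra l k),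
      (weight_le_card (localC_mem_localAlgebra l k)).trans (card_pairQubits k).le,
      (weight_le_card (localD_mem_localAlgebra l k)).trans (card_pairQubits k).le⟩,
    fun k k' h => disjoint_pairQubits h,
    fun k => ⟨uLocal_mem_unitaryGroup l k,
      mem_localAlgebra_iff_supportedOn.1 (uLocal_mem_localAlgebra l k)⟩,
    fun k k' h => disjoint_blockQubits h, uOrd_mem_unitaryGroup l, uPrep_mem_unitaryGroup l,
    fun ψ m => ⟨afterOutcome_uPrep l ψ m, fun k => ?_⟩, fun ψ => ?_⟩, 19, fun n ν l _ => ?_⟩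
  · rw [afterOutcome_uPrep, mulVec_smul, mulVec_mulVec, smul_stab_mul_signedProd]
  · rw [afterOutcome_uPrep, cOrd_eq_signedProd, smul_mulVec, smul_smul, two_rpow_inv_mul_self]
  · have hd := two_mul_succ_le_two_pow ν
    exact ⟨exists_circuit_depth_le (.uOrd l hd) (by omega),
      exists_circuit_depth_le (.uPrep l hd) le_rfl⟩
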